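/- Let $1\le m\le n$ be integers, $p>n/2$, $\sigma,\lambda,T>0$, $\mathbb T^n=(\mathbb R/2\pi\mathbb Z)^n$. For $u=\sum_{j\in\mathbb Z^n}u_je^{ij\cdot x}$ write $j'=(j_1,\dots,j_m)$ and $$\|u\|_{H^s}^2=\sum_j|u_j|^2(1+|j|^2)^s,\qquad \|A^se^{\tau\mathscr A}u\|^2=\sum_j|u_j|^2(1+|j|^2)^se^{2\tau|j'|};$$ $H^s$ and $\mathcal D(A^se^{\tau\mathscr A})$ are the classes on which these are finite, and $A=\sqrt{I-\Delta}$. Consider $$u_{tt}-\Delta u+u+f(t,x,u,\nabla u,u_t)=0\ \text{ on }[0,T]\times\mathbb T^n,\qquad u(0)=u_0,\ u_t(0)=u_1,$$ where $f(t,x,z)=\sum_{j\in\mathbb Z^n}\sum_{\beta\in\mathbb N_0^{n+2}}a_{j\beta}(t)z^\beta e^{ij\cdot x}$ with $a_{j\beta}$ continuous on $[0,T]$, and where the majorising function $$g(t,s)=\sum_{\beta\in\mathbb N_0^{n+2}}\Big(\sum_{j\in\mathbb Z^n}|a_{j\beta}(t)|(1+|j|^2)^{p/2}e^{\lambda|j'|}\Big)s^\beta$$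 converges for all $s=(s_0,\dots,s_{n+1})\in\mathbb R^{n+2}$, $t\in[0,T]$, and is continuous in $(t,s)$. Let $u_0\in\mathcal D(A^{p+1}e^{\sigma\mathscr A})$ and $u_1\in\mathcal D(A^pe^{\sigma\mathscr A})$, and let $u\in C([0,T];H^{p+1})$ with $u_t\in C([0,T];H^p)$, $u_{tt}\in C([0,T];H^{p-1})$ be a solution, i.e. $\langle u_{tt},\phi\rangle+(Au,A\phi)+\langle f(t,x,u,\nabla u,u_t),\phi\rangle=0$ for all $\phi\in H^1$, $t\in[0,T]$, with $u(0)=u_0$, $u_t(0)=u_1$. Put $C_0=2^p\big(2\sum_{j\in\mathbb Z^n}(1+|j|^2)^{-p}\big)^{1/2}$, $\tau_0=\min\{\sigma,\lambda\}$, $Y_0=\big(\|A^pe^{\tau_0\mathscr A}u_1\|^2+\|A^{p+1}e^{\tau_0\mathscr A}u_0\|^2\big)^{1/2}$, and, for a constant $\tilde C>0$, $$\kappa(t)=\tilde C\,g(t,2C_0,\dots,2C_0)+\frac{\tilde C}{2^{n+2}}\,g\big(t,2eC_0\|u(t)\|_{H^{p+1}},\dots,2eC_0\|u(t)\|_{H^{p+1}},2eC_0\|u_t(t)\|_{H^p}\big),$$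 $$Z(t)=Y_0+\int_0^t\kappa(s)\,ds,\qquad S_1=2eC_0\big[1+\|u(t)\|_{H^{p+1}}+Z(t)\big]^{n+2},\qquad S_2=2eC_0\big[1+\|u_t(t)\|_{H^p}+Z(t)\big]^{n+2},$$ $$\eta(t)=2\tilde C\,g(t,S_1,\dots,S_1,S_2)\,Z(t).$$ There is a constant $\tilde C>0$ depending only on $n$ and $p$ such that, in every such situation, $\kappa$ and $\eta\ge0$ are continuous on $[0,T]$, and the solution $$\tau(t)=\tau_0\,e^{-\int_0^t\eta(s)\,ds}$$ of $\tau'=-\tau\eta$, $\tau(0)=\tau_0$, satisfies $$u(t)\in\mathcal D(A^{p+1}e^{\tau(t)\mathscr A}),\qquad u_t(t)\in\mathcal D(A^pe^{\tau(t)\mathscr A})\qquad\text{for all }t\in[0,T].$$ -/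

import Mathlib

open MeasureTheory Set Filter Topology

noncomputable section

namespace GevreyWave

/-! ### The torus, Fourier coefficients, `L²` -/

/-- The torus `ℝⁿ / (2πℤ)ⁿ`, parametrised by `y ∈ (ℝ/ℤ)ⁿ` through `x = 2π y`. Thus the exponential
`e^{i j·x}` is `UnitAddTorus.mFourier j y`, and `∂/∂x_k` acts on it as multiplication by `i j_k`. -/
abbrev Torus (n : ℕ) : Type := UnitAddTorus (Fin n)

/-- Normalised Haar measure `(2π)⁻ⁿ dx` on the torus. -/
abbrev torusMeasure (n : ℕ) : Measure (Torus n) :=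
  Measure.pi (fun _ : Fin n => (AddCircle.haarAddCircle : Measure UnitAddCircle))

/-- `L²(𝕋ⁿ)`, complex valued. -/
abbrev L2 (n : ℕ) : Type := Lp ℂ 2 (torusMeasure n)

/-- Families of Fourier coefficients; periodic distributions are identified with theirs. -/
abbrev Coeffs (n : ℕ) : Type := (Fin n → ℤ) → ℂ

/-- The Fourier coefficients `u_j = (2π)⁻ⁿ ∫ u(x) e^{-i j·x} dx`. -/
def coeffs {n : ℕ} (u : L2 n) : Coeffs n := UnitAddTorus.mFourierCoeff (u : Torus n → ℂ)

/-- `1 + |j|²`. -/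
def japSq {n : ℕ} (j : Fin n → ℤ) : ℝ := 1 + ∑ i, (j i : ℝ) ^ 2

/-- `|j'|`, where `j' = (j_1, …, j_m)` are the first `m` components of `j`. -/
def absHead {n : ℕ} (m : ℕ) (j : Fin n → ℤ) : ℝ :=
  Real.sqrt (∑ i : Fin n with i.val < m, (j i : ℝ) ^ 2)

/-! ### Sobolev and Gevrey-Sobolev classes -/

/-- `c ∈ H^s(𝕋ⁿ) = D(A^s)`, where `A = (I - Δ)^{1/2}`; here `s` is any real number. -/
def MemSobolev {n : ℕ} (s : ℝ) (c : Coeffs n) : Prop :=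
  Summable fun j => ‖c j‖ ^ 2 * japSq j ^ s

/-- `‖c‖_{H^s}`. -/
def sobolevNorm {n : ℕ} (s : ℝ) (c : Coeffs n) : ℝ :=
  Real.sqrt (∑' j, ‖c j‖ ^ 2 * japSq j ^ s)

/-- `c ∈ D(A^s e^{τ𝒜})`, where `𝒜` is the Fourier multiplier `|j'|`. -/
def MemGevrey {n : ℕ} (m : ℕ) (s τ : ℝ) (c : Coeffs n) : Prop :=
  Summable fun j => ‖c j‖ ^ 2 * japSq j ^ s * Real.exp (2 * τ * absHead m j)

/-- `‖A^s e^{τ𝒜} c‖`. -/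
def gevreyNorm {n : ℕ} (m : ℕ) (s τ : ℝ) (c : Coeffs n) : ℝ :=
  Real.sqrt (∑' j, ‖c j‖ ^ 2 * japSq j ^ s * Real.exp (2 * τ * absHead m j))

/-- `c ∈ C([0,T]; H^s)`. -/
def ContSobolev {n : ℕ} (T s : ℝ) (c : ℝ → Coeffs n) : Prop :=
  (∀ t ∈ Icc 0 T, MemSobolev s (c t)) ∧
    ∀ t ∈ Icc 0 T, Tendsto (fun r => sobolevNorm s (c r - c t)) (𝓝[Icc 0 T] t) (𝓝 0)

/-- `d` is the time derivative of `c` on `[0,T]` as a periodic distribution in `x`, that is, tested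
against the exponentials. If moreover `d ∈ C([0,T]; H^s)` and `c(0) ∈ H^s`, then
`c ∈ C¹([0,T]; H^s)` with derivative `d`. -/
def IsTimeDeriv {n : ℕ} (T : ℝ) (c d : ℝ → Coeffs n) : Prop :=
  ∀ t ∈ Icc 0 T, ∀ j, HasDerivWithinAt (fun r => c r j) (d t j) (Icc 0 T) t

/-- `g = ∂w/∂x_k` in the sense of periodic distributions. -/
def IsWeakPartial {n : ℕ} (k : Fin n) (w g : L2 n) : Prop :=
  ∀ j, coeffs g j = Complex.I * (j k : ℂ) * coeffs w j

/-! ### The nonlinearity and its majorant -/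

/-- The list `(s_0, s_1, …, s_n, s_{n+1})`. -/
def slots {α : Type} {n : ℕ} (s₀ : α) (s : Fin n → α) (s₁ : α) : Fin (n + 2) → α :=
  Fin.snoc (α := fun _ => α) (Fin.cons (α := fun _ => α) s₀ s) s₁

/-- Coefficients `a_{jβ}(t)`, `j ∈ ℤⁿ`, `β ∈ ℕ^{n+2}`. -/
abbrev NonlinCoeffs (n : ℕ) : Type := (Fin n → ℤ) → (Fin (n + 2) → ℕ) → ℝ → ℂ

/-- `f(t,x,z) = ∑_j (∑_β a_{jβ}(t) z^β) e^{i j·x}`. -/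
def nonlin {n : ℕ} (a : NonlinCoeffs n) (t : ℝ) (x : Torus n) (z : Fin (n + 2) → ℂ) : ℂ :=
  ∑' j, (∑' β, a j β t * ∏ k, z k ^ β k) * UnitAddTorus.mFourier j x

/-- The summands of `b_β(t) = ∑_j |a_{jβ}(t)| (1+|j|²)^{p/2} e^{λ|j'|}`. -/
def majTerm {n : ℕ} (m : ℕ) (p lam : ℝ) (a : NonlinCoeffs n) (t : ℝ) (β : Fin (n + 2) → ℕ)
    (j : Fin n → ℤ) : ℝ :=
  ‖a j β t‖ * japSq j ^ (p / 2) * Real.exp (lam * absHead m j)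

/-- `b_β(t)`. -/
def majCoeff {n : ℕ} (m : ℕ) (p lam : ℝ) (a : NonlinCoeffs n) (t : ℝ) (β : Fin (n + 2) → ℕ) : ℝ :=
  ∑' j, majTerm m p lam a t β j

/-- The majorising function `g(t,s) = ∑_β b_β(t) s^β`. -/
def majorant {n : ℕ} (m : ℕ) (p lam : ℝ) (a : NonlinCoeffs n) (t : ℝ) (s : Fin (n + 2) → ℝ) : ℝ :=
  ∑' β, majCoeff m p lam a t β * ∏ k, s k ^ β k

/-- The coefficients are continuous in `t`, and the majorising function converges on
`[0,T] × ℝ^{n+2}` and is continuous there. -/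
structure HasEntireMajorant {n : ℕ} (m : ℕ) (p lam T : ℝ) (a : NonlinCoeffs n) : Prop where
  continuousOn_coeff : ∀ j β, ContinuousOn (a j β) (Icc 0 T)
  summable_coeff : ∀ t ∈ Icc 0 T, ∀ β, Summable (majTerm m p lam a t β)
  summable_majorant : ∀ t ∈ Icc 0 T, ∀ s : Fin (n + 2) → ℝ,
    Summable fun β => majCoeff m p lam a t β * ∏ k, s k ^ β k
  continuousOn_majorant :
    ContinuousOn (fun q : ℝ × (Fin (n + 2) → ℝ) => majorant m p lam a q.1 q.2) (Icc 0 T ×ˢ univ)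

/-! ### Solutions of `□u + u + f(t,x,u,∇u,u_t) = 0` -/

/-- `u`, with time derivative `ut`, is a solution on `[0,T]` with initial data `u₀`, `u₁`:
`u ∈ C([0,T];H^r)`, `u_t ∈ C([0,T];H^{r-1})`, `u_tt ∈ C([0,T];H^{r-2})`, and
`⟨u_tt,φ⟩ + (Au,Aφ) + ⟨f(t,x,u,∇u,u_t),φ⟩ = 0` for all `φ ∈ H¹` and `t ∈ [0,T]`.
Here `r ≥ 1`, so `u_tt(t)` is only a periodic distribution, given by its Fourier coefficients. -/
def IsSolution {n : ℕ} (r T : ℝ) (a : NonlinCoeffs n) (u₀ u₁ : L2 n) (u ut : ℝ → L2 n) : Prop :=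
  ContSobolev T r (fun t => coeffs (u t)) ∧
  ContSobolev T (r - 1) (fun t => coeffs (ut t)) ∧
  IsTimeDeriv T (fun t => coeffs (u t)) (fun t => coeffs (ut t)) ∧
  u 0 = u₀ ∧ ut 0 = u₁ ∧
  ∃ utt : ℝ → Coeffs n,
    ContSobolev T (r - 2) utt ∧
    IsTimeDeriv T (fun t => coeffs (ut t)) utt ∧
    ∀ t ∈ Icc 0 T, ∃ du : Fin n → L2 n, (∀ k, IsWeakPartial k (u t) (du k)) ∧
      ∀ φ : L2 n, MemSobolev 1 (coeffs φ) →
        (∑' j, utt t j * starRingEnd ℂ (coeffs φ j))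
          + (∑' j, (japSq j : ℂ) * coeffs (u t) j * starRingEnd ℂ (coeffs φ j))
          + (∫ x, nonlin a t x (slots (u t x) (fun k => du k x) (ut t x)) * starRingEnd ℂ (φ x)
              ∂(torusMeasure n)) = 0

/-! ### The rate `η` -/

/-- The algebra constant `C₀ = 2^p (2 ∑_j (1+|j|²)^{-p})^{1/2}` of `D(A^p e^{τ𝒜})`, `p > n/2`. -/
def algConst (n : ℕ) (p : ℝ) : ℝ :=
  2 ^ p * Real.sqrt (2 * ∑' j : Fin n → ℤ, japSq j ^ (-p))

/-- `κ(t) = C g(t,2C₀,…,2C₀) + C 2^{-(n+2)} g(t,2eC₀‖u(t)‖_{H^{p+1}},…,2eC₀‖u_t(t)‖_{H^p})`. -/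
def kappa {n : ℕ} (C : ℝ) (m : ℕ) (p lam : ℝ) (a : NonlinCoeffs n) (u ut : ℝ → L2 n) (t : ℝ) : ℝ :=
  let C₀ := algConst n p
  let su := 2 * Real.exp 1 * C₀ * sobolevNorm (p + 1) (coeffs (u t))
  let sv := 2 * Real.exp 1 * C₀ * sobolevNorm p (coeffs (ut t))
  C * majorant m p lam a t (fun _ => 2 * C₀)
    + C / 2 ^ (n + 2) * majorant m p lam a t (slots su (fun _ => su) sv)

/-- `ψ(t,N₁,N₂,G₁,G₂) = 2C g(t, 2eC₀[1+N₁+G₁]^{n+2}, …, 2eC₀[1+N₁+G₁]^{n+2},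
2eC₀[1+N₂+G₂]^{n+2})`. -/
def psi {n : ℕ} (C : ℝ) (m : ℕ) (p lam : ℝ) (a : NonlinCoeffs n) (t N₁ N₂ G₁ G₂ : ℝ) : ℝ :=
  let C₀ := algConst n p
  let s₁ := 2 * Real.exp 1 * C₀ * (1 + N₁ + G₁) ^ (n + 2)
  let s₂ := 2 * Real.exp 1 * C₀ * (1 + N₂ + G₂) ^ (n + 2)
  2 * C * majorant m p lam a t (slots s₁ (fun _ => s₁) s₂)

/-- `Y₀ = (‖A^p e^{τ₀𝒜}u₁‖² + ‖A^{p+1} e^{τ₀𝒜}u₀‖²)^{1/2}`. -/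
def initialSize {n : ℕ} (m : ℕ) (p τ₀ : ℝ) (u₀ u₁ : L2 n) : ℝ :=
  Real.sqrt (gevreyNorm m p τ₀ (coeffs u₁) ^ 2 + gevreyNorm m (p + 1) τ₀ (coeffs u₀) ^ 2)

/-- `η(t) = ψ(t, ‖u(t)‖_{H^{p+1}}, ‖u_t(t)‖_{H^p}, Z(t), Z(t)) Z(t)` with
`Z(t) = Y₀ + ∫₀ᵗ κ(s) ds`. -/
def eta {n : ℕ} (C : ℝ) (m : ℕ) (p lam τ₀ : ℝ) (a : NonlinCoeffs n) (u₀ u₁ : L2 n)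
    (u ut : ℝ → L2 n) (t : ℝ) : ℝ :=
  let Z := initialSize m p τ₀ u₀ u₁ + ∫ s in (0 : ℝ)..t, kappa C m p lam a u ut s
  psi C m p lam a t (sobolevNorm (p + 1) (coeffs (u t))) (sobolevNorm p (coeffs (ut t))) Z Z * Z

/-- `τ(t) = τ₀ exp(-∫₀ᵗ η(s) ds)`. -/
def radius (τ₀ : ℝ) (η : ℝ → ℝ) (t : ℝ) : ℝ := τ₀ * Real.exp (-∫ s in (0 : ℝ)..t, η s)

end GevreyWave

end

/-!
The proof is an energy estimate in the norm `G² = ‖A^p e^{τφ} u_t‖² + ‖A^{p+1} e^{τφ} u‖²`, where the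
multiplier `|j'|` is replaced by `φ(j) = min(|j'|, N)`. This `φ` is still subadditive, so the spaces
with weight `(1 + |j|²)^{p/2} e^{τφ(j)}` are convolution algebras with the constant `C₀`
(`WeightedBound.mul`), but it is bounded, so `G` is finite for every solution of Sobolev regularity
and no approximation of the solution is needed. The constant is `2^{n+2}`.

In a single Fourier mode the linear part of the equation conserves the energy
(`hasDerivWithinAt_modeEnergy`), whence the derivative of `G²` is `-2τηD` plus the work of the
nonlinearity, with the dissipation `D = ∑ φ(j) e^{2τφ(j)} (…)`. The weak equation tested against
exponentials and the algebra property bound the nonlinearity by `g` at `C₀` times the analytic norms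
`U = ‖A^{p+1} e^{τφ} u‖` and `V = ‖A^p e^{τφ} u_t‖` (`exists_nonlin_repr`, `weak_equation_bound`).
From `e^{2x} ≤ e·e^x + x e^{2x}` one has either `U ≤ 2e‖u‖_{H^{p+1}}` or `U² ≤ 2τD`, and likewise for
`V` (`multNorm_le_or`). Therefore each monomial in `U`, `V` is at most `1`, plus the same monomial
in the Sobolev norms with the factor `2e`, plus `2τD (1 + G)^{2|β|}` (`pow_mul_pow_le`). Summed over
`β`, the first two parts are covered by `κ` and the third by `η`, as long as `G ≤ Z`
(`energy_production_le`). Thus `(G²)' ≤ 2κG`, and `G ≤ Y₀ + ∫ κ = Z`.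

To close the continuous induction, `η` is first formed with `Z + ε` in place of `Z`
(`sqrt_energy_le`). The bound `G ≤ Z` is independent of `N` and `ε`, and `ε → 0`, `N → ∞` in finite
partial sums gives the Gevrey regularity (`memGevrey_of_tendsto`).
-/

noncomputable section

namespace GevreyWave

variable {n : ℕ}

/-! ### Summability of `(1 + |j|²)^{-p}` and the weights -/

lemma one_le_japSq (j : Fin n → ℤ) : 1 ≤ japSq j :=
  le_add_of_nonneg_right (Finset.sum_nonneg fun _ _ => sq_nonneg _)

lemma japSq_pos (j : Fin n → ℤ) : 0 < japSq j := one_pos.trans_le (one_le_japSq j)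

lemma summable_prod_apply {f : ℤ → ℝ} (hf : Summable f) (h0 : ∀ k, 0 ≤ f k) :
    Summable fun j : Fin n → ℤ => ∏ i, f (j i) := by
  classical
  refine summable_of_sum_le (c := ∏ _i : Fin n, ∑' k, f k)
    (fun j => Finset.prod_nonneg fun i _ => h0 _) fun J => ?_
  have hsub : J ⊆ Fintype.piFinset fun i => J.image fun j => j i := fun j hj =>
    Fintype.mem_piFinset.2 fun i => Finset.mem_image_of_mem _ hj
  calc ∑ j ∈ J, ∏ i, f (j i)
      ≤ ∑ j ∈ Fintype.piFinset fun i => J.image fun j => j i, ∏ i, f (j i) :=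
        Finset.sum_le_sum_of_subset_of_nonneg hsub fun j _ _ =>
          Finset.prod_nonneg fun i _ => h0 _
    _ = ∏ i, ∑ k ∈ J.image fun j => j i, f k := (Finset.prod_univ_sum _ _).symm
    _ ≤ ∏ _i : Fin n, ∑' k, f k :=
        Finset.prod_le_prod (fun i _ => Finset.sum_nonneg fun k _ => h0 k)
          fun i _ => hf.sum_le_tsum _ fun k _ => h0 k

lemma summable_one_add_sq_rpow {q : ℝ} (hq : 1 / 2 < q) :
    Summable fun k : ℤ => (1 + (k : ℝ) ^ 2) ^ (-q) := by
  refine Summable.of_norm_bounded_eventually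
    (Real.summable_abs_int_rpow (b := 2 * q) (by linarith)) ?_
  filter_upwards [(Set.finite_singleton (0 : ℤ)).compl_mem_cofinite] with k hk
  have hk0 : (0 : ℝ) < |(k : ℝ)| := abs_pos.2 (Int.cast_ne_zero.2 hk)
  rw [Real.norm_of_nonneg (by positivity), show -(2 * q) = 2 * (-q) by ring,
    Real.rpow_mul hk0.le]
  refine Real.rpow_le_rpow_of_nonpos (by positivity) ?_ (by linarith)
  rw [Real.rpow_two, sq_abs]
  linarith

lemma summable_japSq_rpow {p : ℝ} (hp : (n : ℝ) / 2 < p) :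
    Summable fun j : Fin n → ℤ => japSq j ^ (-p) := by
  rcases Nat.eq_zero_or_pos n with rfl | hn
  · exact Summable.of_finite
  have hn' : (0 : ℝ) < n := Nat.cast_pos.2 hn
  have hp0 : 0 < p := lt_of_le_of_lt (by positivity) hp
  refine Summable.of_nonneg_of_le (fun j => Real.rpow_nonneg (japSq_pos j).le _) (fun j => ?_)
    (summable_prod_apply (summable_one_add_sq_rpow (q := p / n)
      (by rw [lt_div_iff₀ hn']; linarith)) fun k => by positivity)
  calc japSq j ^ (-p) = ∏ _i : Fin n, japSq j ^ (-(p / n)) := by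
        rw [Finset.prod_const, Finset.card_univ, Fintype.card_fin, ← Real.rpow_natCast,
          ← Real.rpow_mul (japSq_pos j).le]
        congr 1
        field_simp
    _ ≤ ∏ i, (1 + (j i : ℝ) ^ 2) ^ (-(p / n)) := by
        refine Finset.prod_le_prod (fun i _ => Real.rpow_nonneg (japSq_pos j).le _) fun i _ => ?_
        refine Real.rpow_le_rpow_of_nonpos (by positivity) ?_ (neg_nonpos.2 (by positivity))
        exact add_le_add_right (Finset.single_le_sum (f := fun i => (j i : ℝ) ^ 2)
          (fun i _ => sq_nonneg _) (Finset.mem_univ i)) 1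

lemma japSq_le_add (j k : Fin n → ℤ) : japSq j ≤ 2 * (japSq k + japSq (j - k)) := by
  have h : ∑ i, (j i : ℝ) ^ 2 ≤ ∑ i, 2 * ((k i : ℝ) ^ 2 + ((j - k) i : ℝ) ^ 2) := by
    refine Finset.sum_le_sum fun i _ => ?_
    simp only [Pi.sub_apply, Int.cast_sub]
    nlinarith [sq_nonneg (2 * (k i : ℝ) - j i)]
  rw [← Finset.mul_sum, Finset.sum_add_distrib] at h
  unfold japSq
  linarith

/-- The weight `(1 + |j|²)^{p/2} e^{θ φ(j)}`. -/
def weight (p θ : ℝ) (φ : (Fin n → ℤ) → ℝ) (j : Fin n → ℤ) : ℝ :=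
  japSq j ^ (p / 2) * Real.exp (θ * φ j)

lemma weight_pos (p θ : ℝ) (φ : (Fin n → ℤ) → ℝ) (j : Fin n → ℤ) : 0 < weight p θ φ j :=
  mul_pos (Real.rpow_pos_of_pos (japSq_pos j) _) (Real.exp_pos _)

lemma weight_sq (p θ : ℝ) (φ : (Fin n → ℤ) → ℝ) (j : Fin n → ℤ) :
    weight p θ φ j ^ 2 = japSq j ^ p * Real.exp (2 * θ * φ j) := by
  rw [weight, mul_pow, ← Real.rpow_natCast, ← Real.rpow_mul (japSq_pos j).le, ← Real.exp_nat_mul]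
  push_cast
  congr 2 <;> ring

/-- The almost submultiplicativity of the weight that makes the weighted `ℓ²` space a convolution
algebra. -/
lemma weight_sq_le {p θ : ℝ} {φ : (Fin n → ℤ) → ℝ} (hp : 0 ≤ p) (hθ : 0 ≤ θ)
    (hφ : ∀ j k, φ j ≤ φ k + φ (j - k)) (j k : Fin n → ℤ) :
    weight p θ φ j ^ 2 ≤ 4 ^ p * (japSq k ^ (-p) + japSq (j - k) ^ (-p)) *
      (weight p θ φ k ^ 2 * weight p θ φ (j - k) ^ 2) := by
  have hk := japSq_pos k
  have hjk := japSq_pos (j - k)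
  have h1 : japSq j ^ p ≤ 4 ^ p * (japSq k ^ p + japSq (j - k) ^ p) := by
    have hmax : japSq j ≤ 4 * max (japSq k) (japSq (j - k)) := by
      have := japSq_le_add j k
      have := le_max_left (japSq k) (japSq (j - k))
      have := le_max_right (japSq k) (japSq (j - k))
      linarith
    refine (Real.rpow_le_rpow (japSq_pos j).le hmax hp).trans ?_
    rw [Real.mul_rpow (by norm_num) (le_max_of_le_left hk.le)]
    refine mul_le_mul_of_nonneg_left ?_ (by positivity)
    rcases max_choice (japSq k) (japSq (j - k)) with h | h <;> rw [h]
    · linarith [Real.rpow_nonneg hjk.le p]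
    · linarith [Real.rpow_nonneg hk.le p]
  have h2 : Real.exp (2 * θ * φ j) ≤ Real.exp (2 * θ * φ k) * Real.exp (2 * θ * φ (j - k)) := by
    rw [← Real.exp_add, ← mul_add]
    exact Real.exp_le_exp.2 (mul_le_mul_of_nonneg_left (hφ j k) (by positivity))
  simp only [weight_sq]
  refine (mul_le_mul h1 h2 (Real.exp_pos _).le (by positivity)).trans (le_of_eq ?_)
  rw [Real.rpow_neg hk.le, Real.rpow_neg hjk.le]
  have := (Real.rpow_pos_of_pos hk p).ne'
  have := (Real.rpow_pos_of_pos hjk p).ne'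
  field_simp
  ring

lemma algConst_sq {p : ℝ} : algConst n p ^ 2 = 4 ^ p * (2 * ∑' j : Fin n → ℤ, japSq j ^ (-p)) := by
  have h : 0 ≤ ∑' j : Fin n → ℤ, japSq j ^ (-p) :=
    tsum_nonneg fun j => Real.rpow_nonneg (japSq_pos j).le _
  rw [algConst, mul_pow, Real.sq_sqrt (by positivity), ← Real.rpow_natCast, ← Real.rpow_mul
    (by norm_num), mul_comm p, Real.rpow_mul (by norm_num)]
  norm_num

lemma algConst_nonneg {p : ℝ} : 0 ≤ algConst n p :=
  mul_nonneg (by positivity) (Real.sqrt_nonneg _)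

lemma absHead_nonneg (m : ℕ) (j : Fin n → ℤ) : 0 ≤ absHead m j := Real.sqrt_nonneg _

lemma absHead_le_add (m : ℕ) (j k : Fin n → ℤ) : absHead m j ≤ absHead m k + absHead m (j - k) := by
  have key : ∀ j : Fin n → ℤ, absHead m j =
      ‖WithLp.toLp 2 fun i : Fin n => if i.val < m then (j i : ℝ) else 0‖ := by
    intro j
    rw [EuclideanSpace.norm_eq, absHead, Finset.sum_filter]
    congr 1
    refine Finset.sum_congr rfl fun i _ => ?_
    split_ifs <;> simp [*]
  rw [key, key, key]
  refine le_trans (le_of_eq ?_) (norm_add_le _ _)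
  congr 1
  ext i
  simp only [PiLp.add_apply, Pi.sub_apply, Int.cast_sub]
  split_ifs <;> ring

/-- The function `min(|j'|, N)`, bounded and still subadditive. -/
def truncHead (m N : ℕ) (j : Fin n → ℤ) : ℝ := min (absHead m j) N

lemma truncHead_nonneg (m N : ℕ) (j : Fin n → ℤ) : 0 ≤ truncHead m N j :=
  le_min (absHead_nonneg m j) N.cast_nonneg

lemma truncHead_le_absHead (m N : ℕ) (j : Fin n → ℤ) : truncHead m N j ≤ absHead m j :=
  min_le_left _ _

lemma truncHead_le (m N : ℕ) (j : Fin n → ℤ) : truncHead m N j ≤ N := min_le_right _ _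

lemma truncHead_le_add (m N : ℕ) (j k : Fin n → ℤ) :
    truncHead m N j ≤ truncHead m N k + truncHead m N (j - k) := by
  have h := absHead_le_add m j k
  have h1 := absHead_nonneg m k
  have h2 := absHead_nonneg m (j - k)
  have h3 : (0 : ℝ) ≤ N := N.cast_nonneg
  unfold truncHead
  rcases min_cases (absHead m k) (N : ℝ) with ⟨e, _⟩ | ⟨e, _⟩ <;>
  rcases min_cases (absHead m (j - k)) (N : ℝ) with ⟨e', _⟩ | ⟨e', _⟩ <;> rw [e, e']
  · exact (min_le_left _ _).trans h
  all_goals exact (min_le_right _ _).trans (by linarith)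

/-! ### Weighted bounds for Fourier coefficients -/

open UnitAddTorus in
/-- The `j`-th Fourier coefficient as a continuous linear functional on `C(𝕋ⁿ)`. -/
def coeffCLM (j : Fin n → ℤ) : C(Torus n, ℂ) →L[ℂ] ℂ :=
  LinearMap.mkContinuous
    { toFun := fun f => ∫ x, mFourier (-j) x * f x ∂(torusMeasure n)
      map_add' := fun f g => by
        simp only [ContinuousMap.add_apply, mul_add]
        exact integral_add
          ((mFourier (-j) * f).continuous.integrable_of_hasCompactSupport
            (HasCompactSupport.of_compactSpace _))
          ((mFourier (-j) * g).continuous.integrable_of_hasCompactSupport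
            (HasCompactSupport.of_compactSpace _))
      map_smul' := fun c f => by
        simp only [ContinuousMap.smul_apply, smul_eq_mul, RingHom.id_apply]
        rw [← integral_const_mul]
        exact integral_congr_ae (Eventually.of_forall fun x => by ring) } 1 fun f => by
    have h : ∀ x : Torus n, ‖mFourier (-j) x * f x‖ ≤ 1 * ‖f‖ := fun x => by
      rw [norm_mul]
      exact mul_le_mul ((ContinuousMap.norm_coe_le_norm _ x).trans_eq mFourier_norm)
        (f.norm_coe_le_norm x) (norm_nonneg _) zero_le_one
    simpa using norm_integral_le_of_norm_le_const (μ := torusMeasure n)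
      (Eventually.of_forall h)

lemma coeffCLM_mFourier_mul (j k : Fin n → ℤ) (g : C(Torus n, ℂ)) :
    coeffCLM j (UnitAddTorus.mFourier k * g) = coeffCLM (j - k) g := by
  refine integral_congr_ae (Eventually.of_forall fun x => ?_)
  simp only [ContinuousMap.mul_apply, ← mul_assoc]
  rw [← UnitAddTorus.mFourier_add]
  congr 3
  abel

lemma coeffCLM_mFourier (j k : Fin n → ℤ) :
    coeffCLM j (UnitAddTorus.mFourier k) = if j = k then 1 else 0 := by
  have h := orthonormal_iff_ite.1 (UnitAddTorus.orthonormal_mFourier (d := Fin n)) j k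
  rw [ContinuousMap.inner_toLp] at h
  rw [← h]
  refine integral_congr_ae (Eventually.of_forall fun x => ?_)
  simp only [UnitAddTorus.mFourier_neg, mul_comm]

lemma coeffCLM_mul {f : C(Torus n, ℂ)} (hf : Summable fun k => coeffCLM k f)
    (g : C(Torus n, ℂ)) (j : Fin n → ℤ) :
    HasSum (fun k => coeffCLM k f * coeffCLM (j - k) g) (coeffCLM j (f * g)) := by
  have h := (UnitAddTorus.hasSum_mFourier_series_of_summable (f := f) hf).mul_right g
  convert (coeffCLM j).hasSum h using 1
  ext k
  rw [smul_mul_assoc, map_smul, coeffCLM_mFourier_mul, smul_eq_mul]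
  rfl

/-- `WeightedBound w f M` says that the weighted `ℓ²` norm of the Fourier coefficients of `f`, with
weight `w`, is at most `M`; it is phrased through finite partial sums. -/
def WeightedBound (w : (Fin n → ℤ) → ℝ) (f : C(Torus n, ℂ)) (M : ℝ) : Prop :=
  0 ≤ M ∧ ∀ J : Finset (Fin n → ℤ), ∑ j ∈ J, (w j * ‖coeffCLM j f‖) ^ 2 ≤ M ^ 2

lemma WeightedBound.summable {w : (Fin n → ℤ) → ℝ} {f : C(Torus n, ℂ)} {M : ℝ}
    (h : WeightedBound w f M) : Summable fun j => (w j * ‖coeffCLM j f‖) ^ 2 :=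
  summable_of_sum_le (fun _ => sq_nonneg _) h.2

lemma WeightedBound.tsum_le {w : (Fin n → ℤ) → ℝ} {f : C(Torus n, ℂ)} {M : ℝ}
    (h : WeightedBound w f M) : ∑' j, (w j * ‖coeffCLM j f‖) ^ 2 ≤ M ^ 2 :=
  Real.tsum_le_of_sum_le (fun _ => sq_nonneg _) h.2

/-- The Cauchy-Schwarz inequality for series. -/
lemma tsum_mul_le_sqrt {ι : Type*} {f g : ι → ℝ} (hf0 : ∀ i, 0 ≤ f i) (hg0 : ∀ i, 0 ≤ g i)
    (hf : Summable fun i => f i ^ 2) (hg : Summable fun i => g i ^ 2) :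
    (Summable fun i => f i * g i) ∧
      ∑' i, f i * g i ≤ Real.sqrt (∑' i, f i ^ 2) * Real.sqrt (∑' i, g i ^ 2) := by
  have := Real.summable_and_inner_le_Lp_mul_Lq_tsum_of_nonneg Real.HolderConjugate.two_two hf0 hg0
    (by simpa using hf) (by simpa using hg)
  simpa [Real.sqrt_eq_rpow] using this

lemma summable_coeff_of_sq {p θ : ℝ} {φ : (Fin n → ℤ) → ℝ} (hp : (n : ℝ) / 2 < p) (hθ : 0 ≤ θ)
    (hφ0 : ∀ j, 0 ≤ φ j) {c : Coeffs n} (hc : Summable fun j => (weight p θ φ j * ‖c j‖) ^ 2) :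
    Summable fun j => ‖c j‖ := by
  have h1 : Summable fun j : Fin n → ℤ => (japSq j ^ (-(p / 2))) ^ 2 := by
    refine (summable_japSq_rpow hp).congr fun j => ?_
    rw [← Real.rpow_natCast, ← Real.rpow_mul (japSq_pos j).le]
    congr 1
    push_cast
    ring
  refine Summable.of_nonneg_of_le (fun j => norm_nonneg _) (fun j => ?_)
    (tsum_mul_le_sqrt (fun j => Real.rpow_nonneg (japSq_pos j).le _)
      (fun j => mul_nonneg (weight_pos p θ φ j).le (norm_nonneg (c j))) h1 hc).1
  have h2 : 1 ≤ Real.exp (θ * φ j) := Real.one_le_exp (mul_nonneg hθ (hφ0 j))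
  rw [weight, ← mul_assoc, ← mul_assoc, ← Real.rpow_add (japSq_pos j), neg_add_cancel,
    Real.rpow_zero, one_mul]
  exact le_mul_of_one_le_left (norm_nonneg _) h2

/-- The sum over `k` of the kernel in `weight_sq_le` is the square of the algebra constant. -/
lemma hasSum_shift {p : ℝ} (hp : (n : ℝ) / 2 < p) (j : Fin n → ℤ) :
    HasSum (fun k => 4 ^ p * (japSq k ^ (-p) + japSq (j - k) ^ (-p))) (algConst n p ^ 2) := by
  have h := (summable_japSq_rpow hp).hasSum
  have h' : HasSum (fun k : Fin n → ℤ => japSq (j - k) ^ (-p)) (∑' k : Fin n → ℤ, japSq k ^ (-p)) :=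
    (Equiv.subLeft j).hasSum_iff.2 h
  rw [algConst_sq, two_mul]
  exact (h.add h').mul_left _

/-- The algebra property of the weighted space, with the constant `algConst n p`: Cauchy-Schwarz in
the convolution sum, using `weight_sq_le`. -/
lemma WeightedBound.mul {p θ : ℝ} {φ : (Fin n → ℤ) → ℝ} (hp : (n : ℝ) / 2 < p) (hθ : 0 ≤ θ)
    (hφ0 : ∀ j, 0 ≤ φ j) (hφ : ∀ j k, φ j ≤ φ k + φ (j - k)) {f g : C(Torus n, ℂ)} {M M' : ℝ}
    (hf : WeightedBound (weight p θ φ) f M) (hg : WeightedBound (weight p θ φ) g M') :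
    WeightedBound (weight p θ φ) (f * g) (M * (algConst n p * M')) := by
  have hp0 : 0 ≤ p := (lt_of_le_of_lt (by positivity) hp).le
  refine ⟨mul_nonneg hf.1 (mul_nonneg algConst_nonneg hg.1), fun J => ?_⟩
  set w := weight p θ φ with hw
  have hw0 : ∀ j, 0 < w j := weight_pos p θ φ
  set A : (Fin n → ℤ) → ℝ := fun k => w k * ‖coeffCLM k f‖ with hA
  set B : (Fin n → ℤ) → ℝ := fun k => w k * ‖coeffCLM k g‖ with hB
  have hA0 : ∀ k, 0 ≤ A k := fun k => mul_nonneg (hw0 k).le (norm_nonneg _)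
  have hB0 : ∀ k, 0 ≤ B k := fun k => mul_nonneg (hw0 k).le (norm_nonneg _)
  have hAB : ∀ j, Summable fun k => (A k * B (j - k)) ^ 2 := fun j => by
    refine Summable.of_nonneg_of_le (fun k => sq_nonneg _) (fun k => ?_)
      (hf.summable.mul_right (M' ^ 2))
    rw [mul_pow]
    refine mul_le_mul_of_nonneg_left ?_ (sq_nonneg _)
    simpa using hg.2 {j - k}
  have key : ∀ j, (w j * ‖coeffCLM j (f * g)‖) ^ 2
      ≤ algConst n p ^ 2 * ∑' k, (A k * B (j - k)) ^ 2 := fun j => by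
    set K : (Fin n → ℤ) → ℝ := fun k => Real.sqrt (4 ^ p * (japSq k ^ (-p) + japSq (j - k) ^ (-p)))
    have hK2 : ∀ k, K k ^ 2 = 4 ^ p * (japSq k ^ (-p) + japSq (j - k) ^ (-p)) := fun k =>
      Real.sq_sqrt (mul_nonneg (by positivity) (add_nonneg
        (Real.rpow_nonneg (japSq_pos k).le _) (Real.rpow_nonneg (japSq_pos _).le _)))
    have hKs : HasSum (fun k => K k ^ 2) (algConst n p ^ 2) := by
      simpa only [hK2] using hasSum_shift hp j
    obtain ⟨hs, hle⟩ := tsum_mul_le_sqrt (fun k => Real.sqrt_nonneg _)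
      (fun k => mul_nonneg (hA0 k) (hB0 (j - k))) hKs.summable (hAB j)
    have hterm : ∀ k, ‖(w j : ℂ) * (coeffCLM k f * coeffCLM (j - k) g)‖
        ≤ K k * (A k * B (j - k)) := fun k => by
      have h1 : w j ≤ K k * (w k * w (j - k)) := by
        refine le_of_sq_le_sq ?_ (mul_nonneg (Real.sqrt_nonneg _)
          (mul_nonneg (hw0 _).le (hw0 _).le))
        rw [mul_pow, hK2, mul_pow]
        exact weight_sq_le hp0 hθ hφ j k
      rw [norm_mul, norm_mul, Complex.norm_real, Real.norm_of_nonneg (hw0 j).le]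
      calc w j * (‖coeffCLM k f‖ * ‖coeffCLM (j - k) g‖)
          ≤ K k * (w k * w (j - k)) * (‖coeffCLM k f‖ * ‖coeffCLM (j - k) g‖) := by gcongr
        _ = _ := by simp only [hA, hB]; ring
    have hsum := (coeffCLM_mul (summable_coeff_of_sq hp hθ hφ0 hf.summable).of_norm g j).mul_left
      (w j : ℂ)
    have h2 : w j * ‖coeffCLM j (f * g)‖ ≤ ∑' k, K k * (A k * B (j - k)) := by
      have := tsum_of_norm_bounded hs.hasSum hterm
      rwa [hsum.tsum_eq, norm_mul, Complex.norm_real, Real.norm_of_nonneg (hw0 j).le] at this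
    refine (pow_le_pow_left₀ (mul_nonneg (hw0 j).le (norm_nonneg _)) (h2.trans hle) 2).trans
      (le_of_eq ?_)
    rw [mul_pow, Real.sq_sqrt (tsum_nonneg fun _ => sq_nonneg _),
      Real.sq_sqrt (tsum_nonneg fun _ => sq_nonneg _), hKs.tsum_eq]
  calc ∑ j ∈ J, (w j * ‖coeffCLM j (f * g)‖) ^ 2
      ≤ ∑ j ∈ J, algConst n p ^ 2 * ∑' k, (A k * B (j - k)) ^ 2 :=
        Finset.sum_le_sum fun j _ => key j
    _ = algConst n p ^ 2 * ∑' k, ∑ j ∈ J, (A k * B (j - k)) ^ 2 := by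
        rw [← Finset.mul_sum, Summable.tsum_finsetSum fun j _ => hAB j]
    _ ≤ algConst n p ^ 2 * ∑' k, A k ^ 2 * M' ^ 2 := by
        refine mul_le_mul_of_nonneg_left ?_ (sq_nonneg _)
        refine Summable.tsum_le_tsum (fun k => ?_) (summable_sum fun j _ => hAB j)
          (hf.summable.mul_right _)
        simp only [mul_pow, ← Finset.mul_sum]
        refine mul_le_mul_of_nonneg_left ?_ (sq_nonneg _)
        have := hg.2 (J.map (Equiv.subRight k).toEmbedding)
        simpa [hB] using this
    _ ≤ algConst n p ^ 2 * (M ^ 2 * M' ^ 2) := by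
        rw [tsum_mul_right]
        exact mul_le_mul_of_nonneg_left
          (mul_le_mul_of_nonneg_right hf.tsum_le (sq_nonneg _)) (sq_nonneg _)
    _ = (M * (algConst n p * M')) ^ 2 := by ring

lemma WeightedBound.mul_npow {p θ : ℝ} {φ : (Fin n → ℤ) → ℝ} (hp : (n : ℝ) / 2 < p) (hθ : 0 ≤ θ)
    (hφ0 : ∀ j, 0 ≤ φ j) (hφ : ∀ j k, φ j ≤ φ k + φ (j - k)) {f g : C(Torus n, ℂ)} {M M' : ℝ}
    (hf : WeightedBound (weight p θ φ) f M) (hg : WeightedBound (weight p θ φ) g M') (r : ℕ) :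
    WeightedBound (weight p θ φ) (f * g ^ r) (M * (algConst n p * M') ^ r) := by
  induction r with
  | zero => simpa using hf
  | succ r ih =>
    rw [pow_succ, pow_succ, ← mul_assoc, ← mul_assoc]
    exact ih.mul hp hθ hφ0 hφ hg

lemma WeightedBound.mul_prod_pow {p θ : ℝ} {φ : (Fin n → ℤ) → ℝ} (hp : (n : ℝ) / 2 < p)
    (hθ : 0 ≤ θ) (hφ0 : ∀ j, 0 ≤ φ j) (hφ : ∀ j k, φ j ≤ φ k + φ (j - k)) {ι : Type*}
    {f : C(Torus n, ℂ)} {M : ℝ} (hf : WeightedBound (weight p θ φ) f M) {z : ι → C(Torus n, ℂ)}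
    {N : ι → ℝ} (hz : ∀ i, WeightedBound (weight p θ φ) (z i) (N i)) (β : ι → ℕ) (s : Finset ι) :
    WeightedBound (weight p θ φ) (f * ∏ i ∈ s, z i ^ β i)
      (M * ∏ i ∈ s, (algConst n p * N i) ^ β i) := by
  classical
  induction s using Finset.induction_on with
  | empty => simpa using hf
  | insert i s hi ih =>
    have h := ih.mul_npow hp hθ hφ0 hφ (hz i) (β i)
    rw [Finset.prod_insert hi, Finset.prod_insert hi]
    convert h using 1 <;> ring

/-- Minkowski's inequality for series. -/
lemma WeightedBound.hasSum {w : (Fin n → ℤ) → ℝ} {ι : Type*}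
    {f : ι → C(Torus n, ℂ)} {F : C(Torus n, ℂ)} {M : ι → ℝ} (hF : HasSum f F) (hM : Summable M)
    (h : ∀ i, WeightedBound w (f i) (M i)) : WeightedBound w F (∑' i, M i) := by
  refine ⟨tsum_nonneg fun i => (h i).1, fun J => ?_⟩
  set Λ : C(Torus n, ℂ) →L[ℂ] EuclideanSpace ℂ J :=
    (EuclideanSpace.equiv J ℂ).symm.toContinuousLinearMap.comp
      (ContinuousLinearMap.pi fun j : J => (w j : ℂ) • coeffCLM j.1) with hΛ
  have hn : ∀ g, ‖Λ g‖ ^ 2 = ∑ j ∈ J, (w j * ‖coeffCLM j g‖) ^ 2 := fun g => by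
    rw [EuclideanSpace.norm_sq_eq, ← Finset.sum_coe_sort J]
    refine Finset.sum_congr rfl fun j _ => ?_
    have : Λ g j = (w j : ℂ) * coeffCLM j.1 g := rfl
    rw [this, norm_mul, Complex.norm_real, mul_pow, mul_pow, Real.norm_eq_abs, sq_abs]
  rw [← hn]
  refine pow_le_pow_left₀ (norm_nonneg _) ?_ 2
  rw [← (Λ.hasSum hF).tsum_eq]
  refine tsum_of_norm_bounded hM.hasSum fun i => ?_
  refine le_of_sq_le_sq ?_ (h i).1
  rw [hn]
  exact (h i).2 J

/-- A trigonometric series with absolutely summable coefficients has them as Fourier coefficients. -/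
lemma hasSum_mFourier {c : Coeffs n} (hc : Summable fun j => ‖c j‖) :
    ∃ F : C(Torus n, ℂ), HasSum (fun j => c j • (UnitAddTorus.mFourier j : C(Torus n, ℂ))) F ∧
      ∀ j, coeffCLM j F = c j := by
  classical
  have hs : Summable fun j => c j • (UnitAddTorus.mFourier j : C(Torus n, ℂ)) :=
    .of_norm (by simpa only [norm_smul, UnitAddTorus.mFourier_norm, mul_one] using hc)
  refine ⟨_, hs.hasSum, fun j => ?_⟩
  have h := (coeffCLM j).hasSum hs.hasSum
  rw [← h.tsum_eq, tsum_eq_single j]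
  · simp [coeffCLM_mFourier]
  · intro k hk
    simp [coeffCLM_mFourier, hk.symm]

/-- An `L²` function with absolutely summable Fourier coefficients has a continuous
representative. -/
lemma exists_continuous_repr (c : L2 n) (hc : Summable fun j => ‖coeffs c j‖) :
    ∃ F : C(Torus n, ℂ), ⇑F =ᵐ[torusMeasure n] c ∧ ∀ j, coeffCLM j F = coeffs c j := by
  obtain ⟨F, hF, hFc⟩ := hasSum_mFourier hc
  refine ⟨F, ?_, hFc⟩
  have h1 : HasSum (fun j => coeffs c j • (ContinuousMap.toLp 2 (torusMeasure n) ℂ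
      (UnitAddTorus.mFourier j) : L2 n)) (ContinuousMap.toLp 2 (torusMeasure n) ℂ F) := by
    have := (ContinuousMap.toLp (E := ℂ) 2 (torusMeasure n) ℂ).hasSum hF
    refine this.congr_fun fun j => ?_
    simp
  have h2 : HasSum (fun j => coeffs c j • (ContinuousMap.toLp 2 (torusMeasure n) ℂ
      (UnitAddTorus.mFourier j) : L2 n)) c := UnitAddTorus.hasSum_mFourier_series_L2 c
  have h3 := h1.unique h2
  rw [← h3]
  exact (ContinuousMap.coeFn_toLp (torusMeasure n) F).symm

/-! ### The majorising function -/

lemma majTerm_nonneg (m : ℕ) (p lam : ℝ) (a : NonlinCoeffs n) (t : ℝ) (β : Fin (n + 2) → ℕ)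
    (j : Fin n → ℤ) : 0 ≤ majTerm m p lam a t β j :=
  mul_nonneg (mul_nonneg (norm_nonneg _) (Real.rpow_nonneg (japSq_pos j).le _)) (Real.exp_pos _).le

lemma majCoeff_nonneg (m : ℕ) (p lam : ℝ) (a : NonlinCoeffs n) (t : ℝ) (β : Fin (n + 2) → ℕ) :
    0 ≤ majCoeff m p lam a t β :=
  tsum_nonneg fun _ => majTerm_nonneg ..

lemma majorant_nonneg (m : ℕ) (p lam : ℝ) (a : NonlinCoeffs n) (t : ℝ) {s : Fin (n + 2) → ℝ}
    (hs : ∀ k, 0 ≤ s k) : 0 ≤ majorant m p lam a t s :=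
  tsum_nonneg fun _ => mul_nonneg (majCoeff_nonneg ..)
    (Finset.prod_nonneg fun k _ => pow_nonneg (hs k) _)

lemma majorant_mono {m : ℕ} {p lam t : ℝ} {a : NonlinCoeffs n}
    (hg : ∀ s : Fin (n + 2) → ℝ, Summable fun β => majCoeff m p lam a t β * ∏ k, s k ^ β k)
    {s s' : Fin (n + 2) → ℝ} (hs : ∀ k, 0 ≤ s k) (hss' : ∀ k, s k ≤ s' k) :
    majorant m p lam a t s ≤ majorant m p lam a t s' :=
  Summable.tsum_le_tsum (fun _ => mul_le_mul_of_nonneg_left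
    (Finset.prod_le_prod (fun k _ => pow_nonneg (hs k) _)
      fun k _ => pow_le_pow_left₀ (hs k) (hss' k) _) (majCoeff_nonneg ..)) (hg s) (hg s')

lemma slots_cases {α : Type} (P : Fin (n + 2) → α → Prop) {s₀ : α} {s : Fin n → α} {s₁ : α}
    (h₀ : P 0 s₀) (h : ∀ i : Fin n, P i.succ.castSucc (s i)) (h₁ : P (Fin.last _) s₁)
    (k : Fin (n + 2)) : P k (slots s₀ s s₁ k) := by
  refine Fin.lastCases ?_ (fun i => ?_) k
  · simpa [slots] using h₁
  · refine Fin.cases ?_ (fun i => ?_) i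
    · rw [slots, Fin.snoc_castSucc, Fin.cons_zero]
      exact h₀
    · rw [slots, Fin.snoc_castSucc, Fin.cons_succ]
      exact h i

@[simp] lemma slots_zero {α : Type} {s₀ : α} {s : Fin n → α} {s₁ : α} :
    slots s₀ s s₁ 0 = s₀ := rfl

lemma slots_succ {α : Type} {s₀ : α} {s : Fin n → α} {s₁ : α} (i : Fin n) :
    slots s₀ s s₁ i.succ.castSucc = s i := by
  rw [slots, Fin.snoc_castSucc, Fin.cons_succ]

@[simp] lemma slots_last {α : Type} {s₀ : α} {s : Fin n → α} {s₁ : α} :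
    slots s₀ s s₁ (Fin.last _) = s₁ := by
  rw [slots, Fin.snoc_last]

lemma slots_comp {α γ : Type} (f : α → γ) (s₀ : α) (s : Fin n → α) (s₁ : α) (k : Fin (n + 2)) :
    f (slots s₀ s s₁ k) = slots (f s₀) (fun i => f (s i)) (f s₁) k :=
  slots_cases (fun k y => f y = slots (f s₀) (fun i => f (s i)) (f s₁) k)
    (by simp) (fun i => by rw [slots_succ]) (by simp) k

lemma prod_slots_pow (x y : ℝ) (β : Fin (n + 2) → ℕ) :
    ∏ k, slots x (fun _ => x) y k ^ β k
      = x ^ (∑ i : Fin (n + 1), β i.castSucc) * y ^ β (Fin.last _) := by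
  rw [Fin.prod_univ_castSucc, slots_last, ← Finset.prod_pow_eq_pow_sum]
  congr 1
  refine Finset.prod_congr rfl fun i _ => ?_
  refine Fin.cases ?_ (fun i => ?_) i
  · rw [Fin.castSucc_zero, slots_zero]
  · rw [slots_succ]

/-- If `U² ≤ 2X` and `U` occurs in a monomial, then `y ≤ 1 + y²` produces a factor `U²`, hence
`X`. -/
lemma monomial_le_of_sq_le {U V G X : ℝ} (hU : 0 ≤ U) (hV : 0 ≤ V) (hUG : U ≤ G) (hVG : V ≤ G) {r₁ r₂ : ℕ}
    (hr : r₁ ≠ 0) (hX : U ^ 2 ≤ 2 * X) :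
    U ^ r₁ * V ^ r₂ ≤ 1 + 2 * X * ((1 + G) ^ 2) ^ (r₁ + r₂) := by
  obtain ⟨r, rfl⟩ := Nat.exists_eq_succ_of_ne_zero hr
  have hG : 0 ≤ G := hU.trans hUG
  have h1 : U ^ r * V ^ r₂ ≤ (1 + G) ^ (r + r₂) := by
    rw [pow_add]
    gcongr <;> linarith
  have h2 : (U ^ r * V ^ r₂) ^ 2 ≤ ((1 + G) ^ 2) ^ (r + 1 + r₂) := by
    refine (pow_le_pow_left₀ (by positivity) h1 2).trans ?_
    rw [← pow_mul, ← pow_mul]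
    exact pow_le_pow_right₀ (by linarith) (by omega)
  calc U ^ (r + 1) * V ^ r₂ ≤ 1 + (U ^ (r + 1) * V ^ r₂) ^ 2 := by
        nlinarith [sq_nonneg (U ^ (r + 1) * V ^ r₂ - 1)]
    _ = 1 + U ^ 2 * (U ^ r * V ^ r₂) ^ 2 := by ring
    _ ≤ 1 + 2 * X * ((1 + G) ^ 2) ^ (r + 1 + r₂) := by
        gcongr
        exact (sq_nonneg U).trans hX

/-- A monomial in the analytic norms `U`, `V` is controlled by the Sobolev norms `N₁`, `N₂`, up to a
multiple of the dissipation `X`. If one of the two alternatives `U² ≤ 2X`, `V² ≤ 2X` is used, the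
monomial is first replaced by its square through `y ≤ 1 + y²`, so that a full factor `X` appears. -/
lemma pow_mul_pow_le {U V N₁ N₂ G X : ℝ} (hU : 0 ≤ U) (hV : 0 ≤ V) (hN₁ : 0 ≤ N₁) (hN₂ : 0 ≤ N₂)
    (hX : 0 ≤ X) (hUG : U ≤ G) (hVG : V ≤ G)
    (h₁ : U ≤ 2 * Real.exp 1 * N₁ ∨ U ^ 2 ≤ 2 * X) (h₂ : V ≤ 2 * Real.exp 1 * N₂ ∨ V ^ 2 ≤ 2 * X)
    (r₁ r₂ : ℕ) :
    U ^ r₁ * V ^ r₂ ≤ 1 + (2 * Real.exp 1 * N₁) ^ r₁ * (2 * Real.exp 1 * N₂) ^ r₂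
      + 2 * X * ((1 + G) ^ 2) ^ (r₁ + r₂) := by
  have hG : 0 ≤ G := hU.trans hUG
  have p1 : 0 ≤ (2 * Real.exp 1 * N₁) ^ r₁ * (2 * Real.exp 1 * N₂) ^ r₂ := by positivity
  have p2 : 0 ≤ 2 * X * ((1 + G) ^ 2) ^ (r₁ + r₂) := by positivity
  have main : U ^ r₁ ≤ (2 * Real.exp 1 * N₁) ^ r₁ → V ^ r₂ ≤ (2 * Real.exp 1 * N₂) ^ r₂ →
      U ^ r₁ * V ^ r₂ ≤ 1 + (2 * Real.exp 1 * N₁) ^ r₁ * (2 * Real.exp 1 * N₂) ^ r₂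
        + 2 * X * ((1 + G) ^ 2) ^ (r₁ + r₂) := fun a b => by
    have := mul_le_mul a b (by positivity) (by positivity)
    linarith
  by_cases c₁ : r₁ ≠ 0 ∧ U ^ 2 ≤ 2 * X
  · have := monomial_le_of_sq_le hU hV hUG hVG (r₂ := r₂) c₁.1 c₁.2
    linarith
  by_cases c₂ : r₂ ≠ 0 ∧ V ^ 2 ≤ 2 * X
  · have := monomial_le_of_sq_le hV hU hVG hUG (r₂ := r₁) c₂.1 c₂.2
    rw [add_comm r₂, mul_comm (V ^ r₂)] at this
    linarith
  refine main ?_ ?_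
  · by_cases hr : r₁ = 0
    · simp [hr]
    · exact pow_le_pow_left₀ hU (h₁.resolve_right fun h => c₁ ⟨hr, h⟩) _
  · by_cases hr : r₂ = 0
    · simp [hr]
    · exact pow_le_pow_left₀ hV (h₂.resolve_right fun h => c₂ ⟨hr, h⟩) _

/-- Interpolation between the Sobolev norms and the dissipation inside the majorising function. -/
lemma majorant_le {m : ℕ} {p lam t : ℝ} {a : NonlinCoeffs n}
    (hg : ∀ s : Fin (n + 2) → ℝ, Summable fun β => majCoeff m p lam a t β * ∏ k, s k ^ β k)
    {K U V N₁ N₂ G X : ℝ} (hK : 0 ≤ K) (hU : 0 ≤ U) (hV : 0 ≤ V) (hN₁ : 0 ≤ N₁) (hN₂ : 0 ≤ N₂)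
    (hX : 0 ≤ X) (hUG : U ≤ G) (hVG : V ≤ G)
    (h₁ : U ≤ 2 * Real.exp 1 * N₁ ∨ U ^ 2 ≤ 2 * X)
    (h₂ : V ≤ 2 * Real.exp 1 * N₂ ∨ V ^ 2 ≤ 2 * X) :
    majorant m p lam a t (slots (K * U) (fun _ => K * U) (K * V))
      ≤ majorant m p lam a t (fun _ => 2 * K)
        + majorant m p lam a t (slots (2 * Real.exp 1 * K * N₁) (fun _ => 2 * Real.exp 1 * K * N₁)
            (2 * Real.exp 1 * K * N₂))
        + 2 * X * majorant m p lam a t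
            (slots (K * (1 + G) ^ 2) (fun _ => K * (1 + G) ^ 2) (K * (1 + G) ^ 2)) := by
  refine le_trans ?_ (add_le_add_left (add_le_add_left (majorant_mono hg (s := fun _ => K)
    (fun _ => hK) fun _ => by linarith) _) _)
  have e1 : (fun _ => K) = slots (n := n) K (fun _ => K) K := by
    ext k
    exact (slots_comp (fun _ => K) K (fun _ => K) K k)
  rw [e1]
  have hs := fun s => (hg s).hasSum
  refine hasSum_le (fun β => ?_) (hs _) (((hs _).add (hs _)).add ((hs _).mul_left _))
  simp only [prod_slots_pow]
  have hb := majCoeff_nonneg m p lam a t β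
  generalize majCoeff m p lam a t β = b at hb
  generalize (∑ i : Fin (n + 1), β i.castSucc) = r₁
  generalize β (Fin.last (n + 1)) = r₂
  have h := mul_le_mul_of_nonneg_left (pow_mul_pow_le hU hV hN₁ hN₂ hX hUG hVG h₁ h₂ r₁ r₂)
    (mul_nonneg hb (pow_nonneg hK (r₁ + r₂)))
  calc _ = b * K ^ (r₁ + r₂) * (U ^ r₁ * V ^ r₂) := by ring
    _ ≤ _ := h
    _ = _ := by
      simp only [mul_pow, pow_add]
      ring

/-! ### The nonlinearity in the weighted spaces -/

lemma norm_coeff_le_majTerm {m : ℕ} {p lam : ℝ} (hp : 0 ≤ p) (hlam : 0 ≤ lam) (a : NonlinCoeffs n)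
    (t : ℝ) (β : Fin (n + 2) → ℕ) (j : Fin n → ℤ) : ‖a j β t‖ ≤ majTerm m p lam a t β j := by
  rw [majTerm, mul_assoc]
  exact le_mul_of_one_le_right (norm_nonneg _) (one_le_mul_of_one_le_of_one_le
    (Real.one_le_rpow (one_le_japSq j) (by positivity))
    (Real.one_le_exp (mul_nonneg hlam (absHead_nonneg m j))))

lemma summable_prod_mul {ι κ : Type*} {b : ι → κ → ℝ} {c : ι → ℝ} (hb : ∀ i j, 0 ≤ b i j)
    (hc : ∀ i, 0 ≤ c i) (hs : ∀ i, Summable (b i)) (h : Summable fun i => (∑' j, b i j) * c i) :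
    Summable fun q : ι × κ => b q.1 q.2 * c q.1 := by
  refine (summable_prod_of_nonneg fun q => mul_nonneg (hb _ _) (hc _)).2
    ⟨fun i => (hs i).mul_right (c i), ?_⟩
  simpa only [tsum_mul_right] using h

/-- The order of summation in `nonlin` may be interchanged. -/
lemma nonlin_eq_tsum {m : ℕ} {p lam t : ℝ} {a : NonlinCoeffs n} (hp : 0 ≤ p) (hlam : 0 ≤ lam)
    (hs : ∀ β, Summable (majTerm m p lam a t β))
    (hg : ∀ s : Fin (n + 2) → ℝ, Summable fun β => majCoeff m p lam a t β * ∏ k, s k ^ β k)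
    (x : Torus n) (ζ : Fin (n + 2) → ℂ) :
    nonlin a t x ζ
      = ∑' β, (∑' j, a j β t * UnitAddTorus.mFourier j x) * ∏ k, ζ k ^ β k := by
  have hnx : ∀ j : Fin n → ℤ, ‖UnitAddTorus.mFourier j x‖ ≤ 1 := fun j =>
    (ContinuousMap.norm_coe_le_norm _ x).trans_eq UnitAddTorus.mFourier_norm
  have hpr : ∀ β : Fin (n + 2) → ℕ, 0 ≤ ∏ k, ‖ζ k‖ ^ β k := fun β =>
    Finset.prod_nonneg fun k _ => pow_nonneg (norm_nonneg _) _
  have h4 : Summable fun q : (Fin (n + 2) → ℕ) × (Fin n → ℤ) =>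
      majTerm m p lam a t q.1 q.2 * ∏ k, ‖ζ k‖ ^ q.1 k := by
    exact summable_prod_mul (b := fun β j => majTerm m p lam a t β j)
      (c := fun β => ∏ k, ‖ζ k‖ ^ β k) (fun β j => majTerm_nonneg m p lam a t β j) hpr hs
      (hg fun k => ‖ζ k‖)
  have h3 : Summable fun q : (Fin (n + 2) → ℕ) × (Fin n → ℤ) =>
      a q.2 q.1 t * (∏ k, ζ k ^ q.1 k) * UnitAddTorus.mFourier q.2 x := by
    refine .of_norm_bounded h4 fun q => ?_
    rw [norm_mul, norm_mul, norm_prod]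
    simp only [norm_pow]
    exact (mul_le_of_le_one_right (mul_nonneg (norm_nonneg _) (hpr q.1)) (hnx q.2)).trans
      (mul_le_mul_of_nonneg_right (norm_coeff_le_majTerm hp hlam a t q.1 q.2) (hpr q.1))
  rw [nonlin]
  simp only [← tsum_mul_right]
  rw [Summable.tsum_comm (f := fun β j =>
    a j β t * (∏ k, ζ k ^ β k) * UnitAddTorus.mFourier j x) h3]
  exact tsum_congr fun β => tsum_congr fun j => mul_right_comm _ _ _

/-- If the arguments `z_k` are bounded by `N_k` in the weighted space, then `f(t,x,z(x))` is bounded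
there by the majorising function at `C₀ N_k`. -/
lemma exists_nonlin_repr {m : ℕ} {p lam t θ : ℝ} {φ : (Fin n → ℤ) → ℝ} {a : NonlinCoeffs n}
    (hs : ∀ β, Summable (majTerm m p lam a t β))
    (hg : ∀ s : Fin (n + 2) → ℝ, Summable fun β => majCoeff m p lam a t β * ∏ k, s k ^ β k)
    (hp : (n : ℝ) / 2 < p) (hlam : 0 ≤ lam) (hθ : 0 ≤ θ) (hφ0 : ∀ j, 0 ≤ φ j)
    (hφ : ∀ j k, φ j ≤ φ k + φ (j - k)) (hφl : ∀ j, θ * φ j ≤ lam * absHead m j)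
    {z : Fin (n + 2) → C(Torus n, ℂ)} {N : Fin (n + 2) → ℝ}
    (hz : ∀ k, WeightedBound (weight p θ φ) (z k) (N k)) :
    ∃ F : C(Torus n, ℂ), (∀ x, F x = nonlin a t x fun k => z k x) ∧
      WeightedBound (weight p θ φ) F (majorant m p lam a t fun k => algConst n p * N k) := by
  have hp0 : 0 ≤ p := (lt_of_le_of_lt (by positivity) hp).le
  have hale : ∀ β j, ‖a j β t‖ ≤ majTerm m p lam a t β j := fun β j =>
    norm_coeff_le_majTerm hp0 hlam a t β j
  have has : ∀ β, Summable fun j => ‖a j β t‖ := fun β =>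
    Summable.of_nonneg_of_le (fun j => norm_nonneg _) (hale β) (hs β)
  choose A hA hAc using fun β => hasSum_mFourier (has β)
  have hAb : ∀ β, WeightedBound (weight p θ φ) (A β) (majCoeff m p lam a t β) := fun β => by
    refine ⟨majCoeff_nonneg .., fun J => ?_⟩
    refine (Finset.sum_sq_le_sq_sum_of_nonneg fun j _ =>
      mul_nonneg (weight_pos ..).le (norm_nonneg _)).trans
      (pow_le_pow_left₀ (Finset.sum_nonneg fun j _ =>
        mul_nonneg (weight_pos ..).le (norm_nonneg _)) ?_ 2)
    refine le_trans (Finset.sum_le_sum fun j _ => ?_)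
      ((hs β).sum_le_tsum J fun j _ => majTerm_nonneg ..)
    rw [hAc, majTerm, weight, mul_comm, ← mul_assoc]
    exact mul_le_mul_of_nonneg_left (Real.exp_le_exp.2 (hφl j))
      (mul_nonneg (norm_nonneg _) (Real.rpow_nonneg (japSq_pos j).le _))
  have hAn : ∀ β, ‖A β‖ ≤ majCoeff m p lam a t β := fun β => by
    rw [← (hA β).tsum_eq]
    refine tsum_of_norm_bounded (hs β).hasSum fun j => ?_
    rw [norm_smul, UnitAddTorus.mFourier_norm, mul_one]
    exact hale β j
  have hsum : Summable fun β => A β * ∏ k, z k ^ β k := by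
    refine .of_norm_bounded (hg fun k => ‖z k‖) fun β => ?_
    refine (norm_mul_le _ _).trans (mul_le_mul (hAn β) ?_ (norm_nonneg _) (majCoeff_nonneg ..))
    refine (Finset.norm_prod_le _ _).trans (Finset.prod_le_prod (fun k _ => norm_nonneg _) ?_)
    exact fun k _ => norm_pow_le _ _
  refine ⟨∑' β, A β * ∏ k, z k ^ β k, fun x => ?_, ?_⟩
  · rw [nonlin_eq_tsum hp0 hlam hs hg]
    have h1 : HasSum (fun β => A β x * ∏ k, z k x ^ β k) ((∑' β, A β * ∏ k, z k ^ β k) x) := by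
      refine ((ContinuousMap.evalCLM ℂ x).hasSum hsum.hasSum).congr_fun fun β => ?_
      simp
    rw [← h1.tsum_eq]
    refine tsum_congr fun β => ?_
    rw [← ((ContinuousMap.evalCLM ℂ x).hasSum (hA β)).tsum_eq.trans
      (ContinuousMap.evalCLM_apply ℂ x (A β))]
    simp
  · exact WeightedBound.hasSum hsum.hasSum (hg _) fun β =>
      (hAb β).mul_prod_pow hp hθ hφ0 hφ hz β Finset.univ

/-! ### The weak equation, mode by mode -/

/-- `‖A^s e^{θ φ} c‖` for a general Fourier multiplier `φ`; `gevreyNorm` is the case of `|j'|`. -/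
def multNorm (s θ : ℝ) (φ : (Fin n → ℤ) → ℝ) (c : Coeffs n) : ℝ :=
  Real.sqrt (∑' j, ‖c j‖ ^ 2 * japSq j ^ s * Real.exp (2 * θ * φ j))

lemma term_nonneg (s : ℝ) (c : Coeffs n) (j : Fin n → ℤ) : 0 ≤ ‖c j‖ ^ 2 * japSq j ^ s :=
  mul_nonneg (sq_nonneg _) (Real.rpow_nonneg (japSq_pos j).le _)

lemma multNorm_nonneg (s θ : ℝ) (φ : (Fin n → ℤ) → ℝ) (c : Coeffs n) : 0 ≤ multNorm s θ φ c :=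
  Real.sqrt_nonneg _

lemma multNorm_sq (s θ : ℝ) (φ : (Fin n → ℤ) → ℝ) (c : Coeffs n) :
    multNorm s θ φ c ^ 2 = ∑' j, ‖c j‖ ^ 2 * japSq j ^ s * Real.exp (2 * θ * φ j) :=
  Real.sq_sqrt (tsum_nonneg fun j => mul_nonneg (term_nonneg s c j) (Real.exp_pos _).le)

lemma MemSobolev.summable_mul {s : ℝ} {c : Coeffs n} (hc : MemSobolev s c)
    {μ : (Fin n → ℤ) → ℝ} {M : ℝ} (hμ : ∀ j, |μ j| ≤ M) :
    Summable fun j => ‖c j‖ ^ 2 * japSq j ^ s * μ j := by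
  refine .of_norm_bounded (hc.mul_right M) fun j => ?_
  rw [norm_mul, Real.norm_of_nonneg (term_nonneg s c j)]
  exact mul_le_mul_of_nonneg_left (hμ j) (term_nonneg s c j)

lemma abs_exp_le {θ N x : ℝ} (hθ : 0 ≤ θ) (hx : x ≤ N) :
    |Real.exp (2 * θ * x)| ≤ Real.exp (2 * θ * N) := by
  rw [abs_of_pos (Real.exp_pos _)]
  exact Real.exp_le_exp.2 (mul_le_mul_of_nonneg_left hx (by positivity))

lemma weightedBound_of_le {p s θ : ℝ} {φ : (Fin n → ℤ) → ℝ} {F : C(Torus n, ℂ)} {c : Coeffs n}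
    (hc : Summable fun j => ‖c j‖ ^ 2 * japSq j ^ s * Real.exp (2 * θ * φ j))
    (h : ∀ j, ‖coeffCLM j F‖ ^ 2 * japSq j ^ p ≤ ‖c j‖ ^ 2 * japSq j ^ s) :
    WeightedBound (weight p θ φ) F (multNorm s θ φ c) := by
  refine ⟨multNorm_nonneg .., fun J => ?_⟩
  rw [multNorm_sq]
  refine le_trans (Finset.sum_le_sum fun j _ => ?_)
    (hc.sum_le_tsum J fun j _ => mul_nonneg (term_nonneg s c j) (Real.exp_pos _).le)
  rw [mul_pow, weight_sq, mul_comm, ← mul_assoc]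
  exact mul_le_mul_of_nonneg_right (h j) (Real.exp_pos _).le

lemma MemSobolev.summable_norm_coeff {p : ℝ} (hp : (n : ℝ) / 2 < p) {c : Coeffs n}
    (hc : MemSobolev p c) : Summable fun j => ‖c j‖ := by
  refine summable_coeff_of_sq (θ := 0) (φ := fun _ => 0) hp le_rfl (fun _ => le_rfl)
    (hc.congr fun j => ?_)
  rw [mul_pow, weight_sq]
  simp [mul_comm]

lemma japSq_rpow_le_add_one (p : ℝ) (j : Fin n → ℤ) : japSq j ^ p ≤ japSq j ^ (p + 1) :=
  Real.rpow_le_rpow_of_exponent_le (one_le_japSq j) (by linarith)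

lemma MemSobolev.of_add_one {p : ℝ} {c : Coeffs n} (hc : MemSobolev (p + 1) c) :
    MemSobolev p c :=
  Summable.of_nonneg_of_le (fun j => term_nonneg p c j)
    (fun j => mul_le_mul_of_nonneg_left (japSq_rpow_le_add_one p j) (sq_nonneg _)) hc

lemma norm_sq_partial_le {u g : L2 n} {k : Fin n} (h : IsWeakPartial k u g) (p : ℝ)
    (j : Fin n → ℤ) :
    ‖coeffs g j‖ ^ 2 * japSq j ^ p ≤ ‖coeffs u j‖ ^ 2 * japSq j ^ (p + 1) := by
  have h1 : (j k : ℝ) ^ 2 ≤ japSq j :=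
    (Finset.single_le_sum (f := fun i => (j i : ℝ) ^ 2) (fun i _ => sq_nonneg _)
      (Finset.mem_univ k)).trans (le_add_of_nonneg_left zero_le_one)
  have h2 : ‖coeffs g j‖ ^ 2 = (j k : ℝ) ^ 2 * ‖coeffs u j‖ ^ 2 := by
    rw [h j, norm_mul, norm_mul, Complex.norm_I, one_mul, mul_pow, Complex.norm_intCast, sq_abs]
  rw [h2, Real.rpow_add_one (japSq_pos j).ne']
  have h3 := Real.rpow_nonneg (japSq_pos j).le p
  calc (j k : ℝ) ^ 2 * ‖coeffs u j‖ ^ 2 * japSq j ^ p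
      ≤ japSq j * ‖coeffs u j‖ ^ 2 * japSq j ^ p := by gcongr
    _ = _ := by ring

/-- The exponential `e^{i j·x}` as an element of `L²`. -/
def expL2 (j : Fin n → ℤ) : L2 n := ContinuousMap.toLp 2 (torusMeasure n) ℂ (UnitAddTorus.mFourier j)

lemma expL2_ae (j : Fin n → ℤ) : expL2 j =ᵐ[torusMeasure n] UnitAddTorus.mFourier j :=
  ContinuousMap.coeFn_toLp (torusMeasure n) (UnitAddTorus.mFourier j)

lemma coeffs_expL2 (j k : Fin n → ℤ) : coeffs (expL2 j) k = if k = j then 1 else 0 :=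
  (UnitAddTorus.mFourierCoeff_toLp (UnitAddTorus.mFourier j) k).trans (coeffCLM_mFourier k j)

lemma memSobolev_expL2 (s : ℝ) (j : Fin n → ℤ) : MemSobolev s (coeffs (expL2 j)) :=
  summable_of_ne_finset_zero (s := {j}) fun k hk => by
    simp [coeffs_expL2, Finset.notMem_singleton.1 hk]

/-- Tested against the exponentials, the weak equation identifies `u_tt + A²u` with minus the
Fourier coefficients of the nonlinearity, so that the majorising function bounds it. -/
lemma weak_equation_bound {m : ℕ} {p lam T t θ N : ℝ} {φ : (Fin n → ℤ) → ℝ} {a : NonlinCoeffs n}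
    (ha : HasEntireMajorant m p lam T a) (ht : t ∈ Icc 0 T) (hp : (n : ℝ) / 2 < p)
    (hlam : 0 ≤ lam) (hθ : 0 ≤ θ) (hφ0 : ∀ j, 0 ≤ φ j) (hφN : ∀ j, φ j ≤ N)
    (hφ : ∀ j k, φ j ≤ φ k + φ (j - k)) (hφl : ∀ j, θ * φ j ≤ lam * absHead m j)
    {u v : L2 n} {du : Fin n → L2 n} {c : Coeffs n} (hu : MemSobolev (p + 1) (coeffs u))
    (hv : MemSobolev p (coeffs v)) (hdu : ∀ k, IsWeakPartial k u (du k))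
    (hc : ∀ ψ : L2 n, MemSobolev 1 (coeffs ψ) →
      (∑' j, c j * starRingEnd ℂ (coeffs ψ j))
        + (∑' j, (japSq j : ℂ) * coeffs u j * starRingEnd ℂ (coeffs ψ j))
        + (∫ x, nonlin a t x (slots (u x) (fun k => du k x) (v x)) * starRingEnd ℂ (ψ x)
            ∂(torusMeasure n)) = 0)
    (J : Finset (Fin n → ℤ)) :
    ∑ j ∈ J, (weight p θ φ j * ‖c j + (japSq j : ℂ) * coeffs u j‖) ^ 2
      ≤ majorant m p lam a t (slots (algConst n p * multNorm (p + 1) θ φ (coeffs u))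
          (fun _ => algConst n p * multNorm (p + 1) θ φ (coeffs u))
          (algConst n p * multNorm p θ φ (coeffs v))) ^ 2 := by
  have hdu' : ∀ k, MemSobolev p (coeffs (du k)) := fun k =>
    Summable.of_nonneg_of_le (fun j => term_nonneg p _ j) (norm_sq_partial_le (hdu k) p) hu
  obtain ⟨Fu, hFu, hFuc⟩ := exists_continuous_repr u (hu.of_add_one.summable_norm_coeff hp)
  obtain ⟨Fv, hFv, hFvc⟩ := exists_continuous_repr v (hv.summable_norm_coeff hp)
  choose Fd hFd hFdc using fun k =>
    exists_continuous_repr (du k) ((hdu' k).summable_norm_coeff hp)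
  have hsu := hu.summable_mul fun j => abs_exp_le hθ (hφN j)
  have hsv := hv.summable_mul fun j => abs_exp_le hθ (hφN j)
  set U := multNorm (p + 1) θ φ (coeffs u)
  set V := multNorm p θ φ (coeffs v)
  have hz : ∀ k, WeightedBound (weight p θ φ) (slots Fu Fd Fv k) (slots U (fun _ => U) V k) := by
    refine fun k => slots_cases
      (fun k y => WeightedBound (weight p θ φ) y (slots U (fun _ => U) V k)) ?_ (fun i => ?_) ?_ k
    · rw [slots_zero]
      refine weightedBound_of_le hsu fun j => ?_
      rw [hFuc]
      exact mul_le_mul_of_nonneg_left (japSq_rpow_le_add_one p j) (sq_nonneg _)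
    · rw [slots_succ]
      refine weightedBound_of_le hsu fun j => ?_
      rw [hFdc]
      exact norm_sq_partial_le (hdu i) p j
    · rw [slots_last]
      exact weightedBound_of_le hsv fun j => by rw [hFvc]
  obtain ⟨F, hF, hFb⟩ := exists_nonlin_repr (ha.summable_coeff t ht) (ha.summable_majorant t ht)
    hp hlam hθ hφ0 hφ hφl hz
  have hslots : (fun k : Fin (n + 2) => algConst n p * slots U (fun _ => U) V k)
      = slots (algConst n p * U) (fun _ => algConst n p * U) (algConst n p * V) :=
    funext fun k => slots_comp (fun y => algConst n p * y) U (fun _ => U) V k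
  rw [hslots] at hFb
  refine le_trans (le_of_eq (Finset.sum_congr rfl fun j _ => ?_)) (hFb.2 J)
  have h1 := hc (expL2 j) (memSobolev_expL2 1 j)
  rw [tsum_eq_single j fun k hk => by simp [coeffs_expL2, hk],
    tsum_eq_single j fun k hk => by simp [coeffs_expL2, hk]] at h1
  have h2 : (∫ x, nonlin a t x (slots (u x) (fun k => du k x) (v x)) *
      starRingEnd ℂ (expL2 j x) ∂(torusMeasure n)) = coeffCLM j F := by
    refine integral_congr_ae ?_
    filter_upwards [hFu, hFv, ae_all_iff.2 hFd, expL2_ae j] with x hxu hxv hxd hxe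
    rw [hxe, ← hxu, ← hxv, ← UnitAddTorus.mFourier_neg, mul_comm]
    congr 1
    simp only [← hxd]
    rw [hF]
    congr 1
    exact funext fun k => (slots_comp (fun G : C(Torus n, ℂ) => G x) Fu Fd Fv k).symm
  rw [h2] at h1
  simp only [coeffs_expL2, if_true, map_one, mul_one] at h1
  rw [eq_neg_of_add_eq_zero_left h1, norm_neg]

/-! ### Interpolation and the rate of energy production -/

/-- The quantity `‖A^s φ^{1/2} e^{θ φ} c‖²`, by which the energy is dissipated when the exponent `θ`
decreases. -/
def dissipation (s θ : ℝ) (φ : (Fin n → ℤ) → ℝ) (c : Coeffs n) : ℝ :=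
  ∑' j, ‖c j‖ ^ 2 * japSq j ^ s * (φ j * Real.exp (2 * θ * φ j))

lemma dissipation_nonneg (s θ : ℝ) {φ : (Fin n → ℤ) → ℝ} (hφ0 : ∀ j, 0 ≤ φ j) (c : Coeffs n) :
    0 ≤ dissipation s θ φ c :=
  tsum_nonneg fun j => mul_nonneg (term_nonneg s c j) (mul_nonneg (hφ0 j) (Real.exp_pos _).le)

lemma abs_mul_exp_le {θ N x : ℝ} (hθ : 0 ≤ θ) (hx0 : 0 ≤ x) (hx : x ≤ N) :
    |x * Real.exp (2 * θ * x)| ≤ N * Real.exp (2 * θ * N) := by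
  rw [abs_mul, abs_of_nonneg hx0]
  exact mul_le_mul hx (abs_exp_le hθ hx) (abs_nonneg _) (hx0.trans hx)

lemma exp_two_mul_le {x : ℝ} (hx : 0 ≤ x) :
    Real.exp (2 * x) ≤ Real.exp 1 * Real.exp x + x * Real.exp (2 * x) := by
  rcases le_total x 1 with h | h
  · have h1 : Real.exp (2 * x) ≤ Real.exp 1 * Real.exp x := by
      rw [← Real.exp_add]
      exact Real.exp_le_exp.2 (by linarith)
    have : 0 ≤ x * Real.exp (2 * x) := by positivity
    linarith
  · have h1 : Real.exp (2 * x) ≤ x * Real.exp (2 * x) :=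
      le_mul_of_one_le_left (Real.exp_pos _).le h
    have : 0 ≤ Real.exp 1 * Real.exp x := by positivity
    linarith

/-- The analytic norm is controlled either by the Sobolev norm or by the dissipation: summing
`e^{2x} ≤ e·e^x + x e^{2x}` with `x = θ φ(j)` gives `U² ≤ e N U + θ D`. -/
lemma multNorm_le_or {s θ N : ℝ} {φ : (Fin n → ℤ) → ℝ} {c : Coeffs n} (hc : MemSobolev s c)
    (hθ : 0 ≤ θ) (hφ0 : ∀ j, 0 ≤ φ j) (hφN : ∀ j, φ j ≤ N) :
    multNorm s θ φ c ≤ 2 * Real.exp 1 * sobolevNorm s c ∨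
      multNorm s θ φ c ^ 2 ≤ 2 * (θ * dissipation s θ φ c) := by
  have hs1 := hc.summable_mul fun j => abs_exp_le hθ (hφN j)
  have hs2 := hc.summable_mul fun j => abs_mul_exp_le hθ (hφ0 j) (hφN j)
  have hsq : ∀ j, (Real.sqrt (‖c j‖ ^ 2 * japSq j ^ s)) ^ 2 = ‖c j‖ ^ 2 * japSq j ^ s := fun j =>
    Real.sq_sqrt (term_nonneg s c j)
  have hsq' : ∀ j, (Real.sqrt (‖c j‖ ^ 2 * japSq j ^ s) * Real.exp (θ * φ j)) ^ 2
      = ‖c j‖ ^ 2 * japSq j ^ s * Real.exp (2 * θ * φ j) := fun j => by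
    rw [mul_pow, hsq, ← Real.exp_nat_mul]
    push_cast
    ring_nf
  obtain ⟨hs3, hle⟩ := tsum_mul_le_sqrt (f := fun j => Real.sqrt (‖c j‖ ^ 2 * japSq j ^ s))
    (g := fun j => Real.sqrt (‖c j‖ ^ 2 * japSq j ^ s) * Real.exp (θ * φ j))
    (fun j => Real.sqrt_nonneg _) (fun j => mul_nonneg (Real.sqrt_nonneg _) (Real.exp_pos _).le)
    (by simpa only [hsq, MemSobolev] using hc) (by simpa only [hsq'] using hs1)
  simp only [hsq, hsq'] at hle
  have key : multNorm s θ φ c ^ 2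
      ≤ Real.exp 1 * (sobolevNorm s c * multNorm s θ φ c) + θ * dissipation s θ φ c := by
    have h1 : multNorm s θ φ c ^ 2 ≤ Real.exp 1 * ∑' j, (Real.sqrt (‖c j‖ ^ 2 * japSq j ^ s) *
        (Real.sqrt (‖c j‖ ^ 2 * japSq j ^ s) * Real.exp (θ * φ j)))
          + θ * dissipation s θ φ c := by
      rw [multNorm_sq]
      refine hasSum_le (fun j => ?_) hs1.hasSum
        ((hs3.hasSum.mul_left _).add (hs2.hasSum.mul_left θ))
      rw [← mul_assoc (Real.sqrt _), Real.mul_self_sqrt (term_nonneg s c j)]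
      have := mul_le_mul_of_nonneg_left (exp_two_mul_le (mul_nonneg hθ (hφ0 j)))
        (term_nonneg s c j)
      rw [← mul_assoc] at this
      linarith
    refine h1.trans (add_le_add_left (mul_le_mul_of_nonneg_left hle (Real.exp_pos _).le) _)
  by_contra! h
  have h0 := multNorm_nonneg s θ φ c
  have h2 : 2 * Real.exp 1 * sobolevNorm s c * multNorm s θ φ c
      ≤ multNorm s θ φ c * multNorm s θ φ c := mul_le_mul_of_nonneg_right h.1.le h0
  nlinarith [h.2]

lemma sobolevNorm_nonneg (s : ℝ) (c : Coeffs n) : 0 ≤ sobolevNorm s c := Real.sqrt_nonneg _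

lemma slots_le_slots {x₀ x₁ y₀ y₁ : ℝ} (h₀ : x₀ ≤ y₀) (h₁ : x₁ ≤ y₁) (k : Fin (n + 2)) :
    slots x₀ (fun _ => x₀) x₁ k ≤ slots y₀ (fun _ => y₀) y₁ k :=
  slots_cases (fun k x => x ≤ slots y₀ (fun _ => y₀) y₁ k) (by simpa using h₀)
    (fun i => by rwa [slots_succ]) (by simpa using h₁) k

lemma slots_nonneg {x₀ x₁ : ℝ} (h₀ : 0 ≤ x₀) (h₁ : 0 ≤ x₁) (k : Fin (n + 2)) :
    0 ≤ slots x₀ (fun _ => x₀) x₁ k :=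
  slots_cases (fun _ x => 0 ≤ x) h₀ (fun _ => h₀) h₁ k

lemma psi_nonneg (m : ℕ) {C : ℝ} (hC : 0 ≤ C) (p lam : ℝ) (a : NonlinCoeffs n) (t : ℝ)
    {N₁ N₂ G₁ G₂ : ℝ} (hN₁ : 0 ≤ N₁) (hN₂ : 0 ≤ N₂) (hG₁ : 0 ≤ G₁) (hG₂ : 0 ≤ G₂) :
    0 ≤ psi C m p lam a t N₁ N₂ G₁ G₂ := by
  have h := algConst_nonneg (n := n) (p := p)
  exact mul_nonneg (by positivity)
    (majorant_nonneg m p lam a t (slots_nonneg (by positivity) (by positivity)))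

lemma kappa_nonneg (m : ℕ) {C : ℝ} (hC : 0 ≤ C) (p lam : ℝ) (a : NonlinCoeffs n) (u ut : ℝ → L2 n)
    (t : ℝ) : 0 ≤ kappa C m p lam a u ut t := by
  have h := algConst_nonneg (n := n) (p := p)
  have h1 := sobolevNorm_nonneg (p + 1) (coeffs (u t))
  have h2 := sobolevNorm_nonneg p (coeffs (ut t))
  exact add_nonneg (mul_nonneg hC (majorant_nonneg _ _ _ _ _ fun _ => by positivity))
    (mul_nonneg (by positivity)
      (majorant_nonneg m p lam a t (slots_nonneg (by positivity) (by positivity))))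

/-- The nonlinearity produces energy at the rate `κ G` at most, up to a multiple of the dissipation
which the decrease of the radius with rate `ψ Z` compensates, as long as `G ≤ Z`. -/
lemma energy_production_le {m : ℕ} {p lam T t θ N : ℝ} {φ : (Fin n → ℤ) → ℝ} {a : NonlinCoeffs n}
    (ha : HasEntireMajorant m p lam T a) (ht : t ∈ Icc 0 T) (hp : (n : ℝ) / 2 < p)
    (hlam : 0 ≤ lam) (hθ : 0 ≤ θ) (hφ0 : ∀ j, 0 ≤ φ j) (hφN : ∀ j, φ j ≤ N)
    (hφ : ∀ j k, φ j ≤ φ k + φ (j - k)) (hφl : ∀ j, θ * φ j ≤ lam * absHead m j)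
    {u v : ℝ → L2 n} {du : Fin n → L2 n} {c : Coeffs n}
    (hu : MemSobolev (p + 1) (coeffs (u t)))
    (hv : MemSobolev p (coeffs (v t))) (hdu : ∀ k, IsWeakPartial k (u t) (du k))
    (hc : ∀ ψ : L2 n, MemSobolev 1 (coeffs ψ) →
      (∑' j, c j * starRingEnd ℂ (coeffs ψ j))
        + (∑' j, (japSq j : ℂ) * coeffs (u t) j * starRingEnd ℂ (coeffs ψ j))
        + (∫ x, nonlin a t x (slots (u t x) (fun k => du k x) (v t x)) * starRingEnd ℂ (ψ x)
            ∂(torusMeasure n)) = 0)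
    {G Z : ℝ} (hUG : multNorm (p + 1) θ φ (coeffs (u t)) ≤ G)
    (hVG : multNorm p θ φ (coeffs (v t)) ≤ G) (hGZ : G ≤ Z) (J : Finset (Fin n → ℤ)) :
    ∑ j ∈ J, 2 * (weight p θ φ j * ‖coeffs (v t) j‖) *
        (weight p θ φ j * ‖c j + (japSq j : ℂ) * coeffs (u t) j‖)
      ≤ 2 * kappa (2 ^ (n + 2)) m p lam a u v t * G
        + 2 * θ * (psi (2 ^ (n + 2)) m p lam a t (sobolevNorm (p + 1) (coeffs (u t)))
            (sobolevNorm p (coeffs (v t))) Z Z * Z)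
          * (dissipation (p + 1) θ φ (coeffs (u t)) + dissipation p θ φ (coeffs (v t))) := by
  have hC₀ := algConst_nonneg (n := n) (p := p)
  have hb := weak_equation_bound ha ht hp hlam hθ hφ0 hφN hφ hφl hu hv hdu hc J
  have hU0 := multNorm_nonneg (p + 1) θ φ (coeffs (u t))
  have hV0 := multNorm_nonneg p θ φ (coeffs (v t))
  have hN₁ := sobolevNorm_nonneg (p + 1) (coeffs (u t))
  have hN₂ := sobolevNorm_nonneg p (coeffs (v t))
  have hD₁ := dissipation_nonneg (p + 1) θ hφ0 (coeffs (u t))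
  have hD₂ := dissipation_nonneg p θ hφ0 (coeffs (v t))
  have hVJ : ∑ j ∈ J, (weight p θ φ j * ‖coeffs (v t) j‖) ^ 2
      ≤ multNorm p θ φ (coeffs (v t)) ^ 2 := by
    rw [multNorm_sq]
    refine le_trans (le_of_eq (Finset.sum_congr rfl fun j _ => ?_))
      ((hv.summable_mul fun j => abs_exp_le hθ (hφN j)).sum_le_tsum J
        fun j _ => mul_nonneg (term_nonneg p _ j) (Real.exp_pos _).le)
    rw [mul_pow, weight_sq]
    ring
  have hor₁ := multNorm_le_or hu hθ hφ0 hφN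
  have hor₂ := multNorm_le_or hv hθ hφ0 hφN
  set U := multNorm (p + 1) θ φ (coeffs (u t))
  set V := multNorm p θ φ (coeffs (v t))
  set N₁ := sobolevNorm (p + 1) (coeffs (u t)) with hN₁_def
  set N₂ := sobolevNorm p (coeffs (v t)) with hN₂_def
  set D₁ := dissipation (p + 1) θ φ (coeffs (u t))
  set D₂ := dissipation p θ φ (coeffs (v t))
  have hG : 0 ≤ G := hU0.trans hUG
  have hZ : 0 ≤ Z := hG.trans hGZ
  have hg := ha.summable_majorant t ht
  have hmaj := majorant_le hg hC₀ hU0 hV0 hN₁ hN₂ (X := θ * (D₁ + D₂)) (by positivity) hUG hVG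
    (hor₁.imp_right fun h => h.trans (by nlinarith)) (hor₂.imp_right fun h => h.trans (by nlinarith))
  -- the arguments of `psi` dominate `C₀ (1 + G)²`, because `2 ≤ n + 2`
  have harg : ∀ N, 0 ≤ N → algConst n p * (1 + G) ^ 2
      ≤ 2 * Real.exp 1 * algConst n p * (1 + N + Z) ^ (n + 2) := fun N hN => by
    have h1 : (1 + G) ^ 2 ≤ (1 + N + Z) ^ (n + 2) :=
      (pow_le_pow_left₀ (by positivity) (by linarith) 2).trans
        (pow_le_pow_right₀ (by linarith) (by omega))
    have h2 : 1 ≤ 2 * Real.exp 1 := by linarith [Real.add_one_le_exp 1]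
    calc algConst n p * (1 + G) ^ 2 ≤ algConst n p * (1 + N + Z) ^ (n + 2) := by gcongr
      _ ≤ 2 * Real.exp 1 * (algConst n p * (1 + N + Z) ^ (n + 2)) :=
        le_mul_of_one_le_left (by positivity) h2
      _ = _ := by ring
  have hmono := majorant_mono hg (slots_nonneg (x₀ := algConst n p * (1 + G) ^ 2)
    (x₁ := algConst n p * (1 + G) ^ 2) (by positivity) (by positivity))
    (slots_le_slots (harg N₁ hN₁) (harg N₂ hN₂))
  have hg0 := majorant_nonneg m p lam a t (slots_nonneg (n := n)
    (x₀ := algConst n p * (1 + G) ^ 2) (x₁ := algConst n p * (1 + G) ^ 2) (by positivity)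
    (by positivity))
  have hg1 := majorant_nonneg m p lam a t (s := fun _ => 2 * algConst n p) fun _ => by positivity
  have hC : (1 : ℝ) ≤ 2 ^ (n + 2) := one_le_pow₀ one_le_two
  have hkappa : majorant m p lam a t (fun _ => 2 * algConst n p)
        + majorant m p lam a t (slots (2 * Real.exp 1 * algConst n p * N₁)
            (fun _ => 2 * Real.exp 1 * algConst n p * N₁) (2 * Real.exp 1 * algConst n p * N₂))
      ≤ kappa (2 ^ (n + 2)) m p lam a u v t := by
    simp only [kappa, ← hN₁_def, ← hN₂_def, div_self (zero_lt_one.trans_le hC).ne', one_mul]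
    exact add_le_add_left (le_mul_of_one_le_left hg1 hC) _
  have hpsi : 2 * majorant m p lam a t (slots (algConst n p * (1 + G) ^ 2)
        (fun _ => algConst n p * (1 + G) ^ 2) (algConst n p * (1 + G) ^ 2)) * G
      ≤ psi (2 ^ (n + 2)) m p lam a t N₁ N₂ Z Z * Z := by
    simp only [psi]
    refine mul_le_mul ?_ hGZ hG (mul_nonneg (by positivity) (hg0.trans hmono))
    exact mul_le_mul (by linarith) hmono hg0 (by positivity)
  calc _ = 2 * ∑ j ∈ J, (weight p θ φ j * ‖coeffs (v t) j‖) *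
        (weight p θ φ j * ‖c j + (japSq j : ℂ) * coeffs (u t) j‖) := by
        rw [Finset.mul_sum]
        exact Finset.sum_congr rfl fun j _ => by ring
    _ ≤ 2 * (V * majorant m p lam a t (slots (algConst n p * U) (fun _ => algConst n p * U)
          (algConst n p * V))) := by
        refine mul_le_mul_of_nonneg_left ?_ zero_le_two
        refine (Real.sum_mul_le_sqrt_mul_sqrt _ _ _).trans ?_
        refine mul_le_mul (Real.sqrt_le_iff.2 ⟨hV0, hVJ⟩) (Real.sqrt_le_iff.2 ⟨?_, hb⟩)
          (Real.sqrt_nonneg _) hV0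
        exact majorant_nonneg m p lam a t (slots_nonneg (by positivity) (by positivity))
    _ ≤ 2 * (G * (kappa (2 ^ (n + 2)) m p lam a u v t + 2 * (θ * (D₁ + D₂)) *
          majorant m p lam a t (slots (algConst n p * (1 + G) ^ 2)
            (fun _ => algConst n p * (1 + G) ^ 2) (algConst n p * (1 + G) ^ 2)))) := by
        refine mul_le_mul_of_nonneg_left ?_ zero_le_two
        refine mul_le_mul hVG (hmaj.trans (add_le_add_left hkappa _))
          (majorant_nonneg m p lam a t (slots_nonneg (by positivity) (by positivity))) hG
    _ = 2 * kappa (2 ^ (n + 2)) m p lam a u v t * G + 2 * θ * (2 * majorant m p lam a t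
          (slots (algConst n p * (1 + G) ^ 2) (fun _ => algConst n p * (1 + G) ^ 2)
            (algConst n p * (1 + G) ^ 2)) * G) * (D₁ + D₂) := by ring
    _ ≤ _ := by gcongr

/-! ### Continuity in time -/

lemma MemSobolev.sub {s : ℝ} {c d : Coeffs n} (hc : MemSobolev s c) (hd : MemSobolev s d) :
    MemSobolev s (c - d) := by
  refine Summable.of_nonneg_of_le (fun j => term_nonneg s _ j) (fun j => ?_)
    ((hc.mul_left 2).add (hd.mul_left 2))
  have h1 : ‖(c - d) j‖ ^ 2 ≤ 2 * ‖c j‖ ^ 2 + 2 * ‖d j‖ ^ 2 := by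
    have := norm_sub_le (c j) (d j)
    have h2 : ‖(c - d) j‖ ^ 2 ≤ (‖c j‖ + ‖d j‖) ^ 2 := pow_le_pow_left₀ (norm_nonneg _) this 2
    nlinarith [sq_nonneg (‖c j‖ - ‖d j‖)]
  have := mul_le_mul_of_nonneg_right h1 (Real.rpow_nonneg (japSq_pos j).le s)
  linarith

lemma sobolevNorm_sq (s : ℝ) (c : Coeffs n) :
    sobolevNorm s c ^ 2 = ∑' j, ‖c j‖ ^ 2 * japSq j ^ s :=
  Real.sq_sqrt (tsum_nonneg fun j => term_nonneg s c j)

lemma abs_norm_sq_sub_le (x y : ℂ) :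
    |‖x‖ ^ 2 - ‖y‖ ^ 2| ≤ ‖x - y‖ ^ 2 + 2 * (‖x - y‖ * ‖y‖) := by
  have h := abs_norm_sub_norm_le x y
  have h1 : ‖x‖ ^ 2 - ‖y‖ ^ 2 = (‖x‖ - ‖y‖) * ((‖x‖ - ‖y‖) + 2 * ‖y‖) := by ring
  have h2 : |(‖x‖ - ‖y‖) + 2 * ‖y‖| ≤ ‖x - y‖ + 2 * ‖y‖ := by
    refine (abs_add_le _ _).trans (add_le_add h ?_)
    rw [abs_of_nonneg (by positivity)]
  rw [h1, abs_mul]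
  calc _ ≤ ‖x - y‖ * (‖x - y‖ + 2 * ‖y‖) :=
        mul_le_mul h h2 (abs_nonneg _) (norm_nonneg _)
    _ = _ := by ring

lemma abs_tsum_sq_sub_le {s M : ℝ} {c d : Coeffs n} (hc : MemSobolev s c) (hd : MemSobolev s d)
    {μ : (Fin n → ℤ) → ℝ} (hμ : ∀ j, |μ j| ≤ M) :
    |∑' j, ‖c j‖ ^ 2 * japSq j ^ s * μ j - ∑' j, ‖d j‖ ^ 2 * japSq j ^ s * μ j|
      ≤ M * (sobolevNorm s (c - d) ^ 2 + 2 * (sobolevNorm s (c - d) * sobolevNorm s d)) := by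
  have hcd := hc.sub hd
  have hsq : ∀ (e : Coeffs n) j, (Real.sqrt (‖e j‖ ^ 2 * japSq j ^ s)) ^ 2
      = ‖e j‖ ^ 2 * japSq j ^ s := fun e j => Real.sq_sqrt (term_nonneg s e j)
  have hsqrt : ∀ (e : Coeffs n) j, Real.sqrt (‖e j‖ ^ 2 * japSq j ^ s)
      = ‖e j‖ * Real.sqrt (japSq j ^ s) := fun e j => by
    rw [Real.sqrt_mul (sq_nonneg _), Real.sqrt_sq (norm_nonneg _)]
  obtain ⟨hs, hle⟩ := tsum_mul_le_sqrt
    (f := fun j => Real.sqrt (‖(c - d) j‖ ^ 2 * japSq j ^ s))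
    (g := fun j => Real.sqrt (‖d j‖ ^ 2 * japSq j ^ s))
    (fun j => Real.sqrt_nonneg _) (fun j => Real.sqrt_nonneg _)
    (by simpa only [hsq, MemSobolev] using hcd) (by simpa only [hsq, MemSobolev] using hd)
  simp only [hsq] at hle
  have hM : 0 ≤ M := (abs_nonneg _).trans (hμ 0)
  rw [← (hc.summable_mul hμ).tsum_sub (hd.summable_mul hμ), ← Real.norm_eq_abs]
  refine (tsum_of_norm_bounded ((hcd.hasSum.add (hs.hasSum.mul_left 2)).mul_left M)
    fun j => ?_).trans ?_
  · rw [Real.norm_eq_abs, ← sub_mul, ← sub_mul, abs_mul, abs_mul,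
      abs_of_nonneg (Real.rpow_nonneg (japSq_pos j).le s), mul_comm, hsqrt, hsqrt]
    refine mul_le_mul (hμ j) ?_ (mul_nonneg (abs_nonneg _)
      (Real.rpow_nonneg (japSq_pos j).le s)) hM
    refine (mul_le_mul_of_nonneg_right (abs_norm_sq_sub_le (c j) (d j))
      (Real.rpow_nonneg (japSq_pos j).le s)).trans (le_of_eq ?_)
    rw [mul_mul_mul_comm, Real.mul_self_sqrt (Real.rpow_nonneg (japSq_pos j).le s), Pi.sub_apply]
    ring
  · refine mul_le_mul_of_nonneg_left ?_ hM
    rw [sobolevNorm_sq]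
    exact add_le_add_right (mul_le_mul_of_nonneg_left hle zero_le_two) _

/-- Quadratic expressions `∑ μ_j(t) |c_j(t)|² (1 + |j|²)^s` with bounded, continuous `μ_j` are
continuous along `c ∈ C([0,T]; H^s)`. -/
lemma ContSobolev.continuousOn_tsum {T s M : ℝ} {c : ℝ → Coeffs n} (hc : ContSobolev T s c)
    {μ : ℝ → (Fin n → ℤ) → ℝ} (hμ : ∀ r ∈ Icc 0 T, ∀ j, |μ r j| ≤ M)
    (hμc : ∀ j, ContinuousOn (fun r => μ r j) (Icc 0 T)) :
    ContinuousOn (fun r => ∑' j, ‖c r j‖ ^ 2 * japSq j ^ s * μ r j) (Icc 0 T) := by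
  intro t ht
  have h1 : Tendsto (fun r => ∑' j, ‖c t j‖ ^ 2 * japSq j ^ s * μ r j) (𝓝[Icc 0 T] t)
      (𝓝 (∑' j, ‖c t j‖ ^ 2 * japSq j ^ s * μ t j)) := by
    refine tendsto_tsum_of_dominated_convergence ((hc.1 t ht).mul_right M)
      (fun j => (hμc j t ht).tendsto.const_mul _) ?_
    filter_upwards [self_mem_nhdsWithin] with r hr j
    rw [norm_mul, Real.norm_of_nonneg (term_nonneg s (c t) j)]
    exact mul_le_mul_of_nonneg_left (hμ r hr j) (term_nonneg s (c t) j)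
  have h2 : Tendsto (fun r => ∑' j, ‖c r j‖ ^ 2 * japSq j ^ s * μ r j
      - ∑' j, ‖c t j‖ ^ 2 * japSq j ^ s * μ r j) (𝓝[Icc 0 T] t) (𝓝 0) := by
    have hn := hc.2 t ht
    have h3 : Tendsto (fun r => M * (sobolevNorm s (c r - c t) ^ 2
        + 2 * (sobolevNorm s (c r - c t) * sobolevNorm s (c t)))) (𝓝[Icc 0 T] t) (𝓝 0) := by
      have := ((hn.pow 2).add ((hn.mul_const (sobolevNorm s (c t))).const_mul 2)).const_mul M
      simpa using this
    refine squeeze_zero_norm' ?_ h3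
    filter_upwards [self_mem_nhdsWithin] with r hr
    exact abs_tsum_sq_sub_le (hc.1 r hr) (hc.1 t ht) (hμ r hr)
  have := h2.add h1
  simpa [ContinuousWithinAt] using this

lemma ContSobolev.continuousOn_sobolevNorm {T s : ℝ} {c : ℝ → Coeffs n} (hc : ContSobolev T s c) :
    ContinuousOn (fun r => sobolevNorm s (c r)) (Icc 0 T) := by
  have := (hc.continuousOn_tsum (μ := fun _ _ => 1) (M := 1) (by simp)
    fun _ => continuousOn_const).sqrt
  simp only [mul_one] at this
  exact this

/-! ### Calculus on a compact interval -/

lemma intervalIntegrable_of_continuousOn {T t : ℝ} {f : ℝ → ℝ} (hf : ContinuousOn f (Icc 0 T))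
    (ht : t ∈ Icc 0 T) : IntervalIntegrable f volume 0 t :=
  (hf.mono (by rw [uIcc_of_le ht.1]; exact Icc_subset_Icc_right ht.2)).intervalIntegrable

lemma hasDerivWithinAt_integral {T t : ℝ} {f : ℝ → ℝ} (hf : ContinuousOn f (Icc 0 T))
    (ht : t ∈ Icc 0 T) :
    HasDerivWithinAt (fun x => ∫ s in (0 : ℝ)..x, f s) (f t) (Icc 0 T) t := by
  have : Fact (t ∈ Icc 0 T) := ⟨ht⟩
  exact intervalIntegral.integral_hasDerivWithinAt_right
    (intervalIntegrable_of_continuousOn hf ht)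
    (hf.stronglyMeasurableAtFilter_nhdsWithin measurableSet_Icc t) (hf t ht)

lemma continuousOn_integral {T : ℝ} {f : ℝ → ℝ} (hf : ContinuousOn f (Icc 0 T)) :
    ContinuousOn (fun x => ∫ s in (0 : ℝ)..x, f s) (Icc 0 T) := fun _ ht =>
  (hasDerivWithinAt_integral hf ht).continuousWithinAt

lemma integral_nonneg_of_Icc {T t : ℝ} {f : ℝ → ℝ} (h0 : ∀ s ∈ Icc 0 T, 0 ≤ f s)
    (ht : t ∈ Icc 0 T) : 0 ≤ ∫ s in (0 : ℝ)..t, f s :=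
  intervalIntegral.integral_nonneg ht.1 fun s hs => h0 s ⟨hs.1, hs.2.trans ht.2⟩

lemma le_of_hasDerivWithinAt_le {T : ℝ} {f g f' g' : ℝ → ℝ}
    (hf : ∀ t ∈ Icc 0 T, HasDerivWithinAt f (f' t) (Icc 0 T) t)
    (hg : ∀ t ∈ Icc 0 T, HasDerivWithinAt g (g' t) (Icc 0 T) t) (h0 : f 0 ≤ g 0)
    (h : ∀ t ∈ Icc 0 T, f' t ≤ g' t) {t : ℝ} (ht : t ∈ Icc 0 T) : f t ≤ g t := by
  have key : ∀ x ∈ Ico 0 T, Icc 0 T ∈ 𝓝[≥] x := fun x hx => Icc_mem_nhdsGE_of_mem hx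
  exact image_le_of_deriv_right_le_deriv_boundary (fun x hx => (hf x hx).continuousWithinAt)
    (fun x hx => (hf x (Ico_subset_Icc_self hx)).mono_of_mem_nhdsWithin (key x hx)) h0
    (fun x hx => (hg x hx).continuousWithinAt)
    (fun x hx => (hg x (Ico_subset_Icc_self hx)).mono_of_mem_nhdsWithin (key x hx))
    (fun x hx => h x (Ico_subset_Icc_self hx)) ht

/-- A Gronwall inequality of Bihari type: `y² ≤ y₀² + ∫ 2κy` implies `y ≤ y₀ + ∫ κ`. -/
lemma le_add_integral_of_sq_le {T y₀ : ℝ} {y κ : ℝ → ℝ} (hy : ContinuousOn y (Icc 0 T))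
    (hκ : ContinuousOn κ (Icc 0 T)) (hκ0 : ∀ t ∈ Icc 0 T, 0 ≤ κ t) (hy₀ : 0 ≤ y₀)
    (hynn : ∀ t ∈ Icc 0 T, 0 ≤ y t)
    (h : ∀ t ∈ Icc 0 T, y t ^ 2 ≤ y₀ ^ 2 + ∫ s in (0 : ℝ)..t, 2 * κ s * y s) {t : ℝ}
    (ht : t ∈ Icc 0 T) : y t ≤ y₀ + ∫ s in (0 : ℝ)..t, κ s := by
  refine le_of_forall_pos_le_add fun δ hδ => ?_
  have hκy : ContinuousOn (fun s => 2 * κ s * y s) (Icc 0 T) :=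
    (continuousOn_const.mul hκ).mul hy
  set Φ : ℝ → ℝ := fun t => y₀ ^ 2 + δ ^ 2 + ∫ s in (0 : ℝ)..t, 2 * κ s * y s with hΦ
  have hΦpos : ∀ t ∈ Icc 0 T, 0 < Φ t := fun t ht => by
    have := integral_nonneg_of_Icc
      (fun s hs => mul_nonneg (mul_nonneg zero_le_two (hκ0 s hs)) (hynn s hs)) ht
    have : 0 < δ ^ 2 := by positivity
    have := sq_nonneg y₀
    simp only [hΦ]
    linarith
  have hyΦ : ∀ t ∈ Icc 0 T, y t ≤ Real.sqrt (Φ t) := fun t ht =>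
    Real.le_sqrt_of_sq_le (by have := h t ht; have := sq_nonneg δ; simp only [hΦ]; linarith)
  have hd : ∀ t ∈ Icc 0 T, HasDerivWithinAt (fun t => Real.sqrt (Φ t))
      (2 * κ t * y t / (2 * Real.sqrt (Φ t))) (Icc 0 T) t := fun t ht =>
    ((hasDerivWithinAt_integral hκy ht).const_add _).sqrt (hΦpos t ht).ne'
  have hd' : ∀ t ∈ Icc 0 T, HasDerivWithinAt (fun t => y₀ + δ + ∫ s in (0 : ℝ)..t, κ s)
      (κ t) (Icc 0 T) t := fun t ht => (hasDerivWithinAt_integral hκ ht).const_add _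
  have := le_of_hasDerivWithinAt_le hd hd' (by
    simp only [hΦ, intervalIntegral.integral_same, add_zero]
    exact Real.sqrt_le_iff.2 ⟨by positivity, by nlinarith⟩) (fun s hs => by
    have h1 := Real.sqrt_pos.2 (hΦpos s hs)
    rw [div_le_iff₀ (by positivity)]
    have := mul_le_mul_of_nonneg_left (hyΦ s hs) (mul_nonneg zero_le_two (hκ0 s hs))
    linarith) ht
  have h2 := hyΦ t ht
  linarith

/-- Continuous induction: if the bound `G ≤ Z + ε` up to time `t` improves to `G ≤ Z` at `t`, then
`G ≤ Z` throughout. -/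
lemma le_of_bootstrap {T ε : ℝ} {G Z : ℝ → ℝ} (hG : ContinuousOn G (Icc 0 T))
    (hZ : ContinuousOn Z (Icc 0 T)) (hε : 0 < ε) (h0 : G 0 ≤ Z 0)
    (h : ∀ t ∈ Icc 0 T, (∀ s ∈ Icc 0 t, G s ≤ Z s + ε) → G t ≤ Z t) {t : ℝ} (ht : t ∈ Icc 0 T) :
    G t ≤ Z t := by
  have hsub : Icc 0 T ⊆ {t | G t ≤ Z t + ε} := by
    refine IsClosed.Icc_subset_of_forall_mem_nhdsGT_of_Icc_subset ?_ ?_ fun x hx hx' => ?_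
    · have := isClosed_Icc.isClosed_le hG (hZ.add_const ε)
      convert this using 1
      ext x
      exact and_comm
    · change G 0 ≤ Z 0 + ε
      linarith
    · have hxT := Ico_subset_Icc_self hx
      have hlt : G x < Z x + ε := (h x hxT hx').trans_lt (lt_add_of_pos_right _ hε)
      have hev := (hG x hxT).eventually_lt ((hZ x hxT).add_const ε) hlt
      have hle : 𝓝[>] x ≤ 𝓝[Icc 0 T] x :=
        nhdsWithin_le_of_mem (mem_of_superset (Ioo_mem_nhdsGT hx.2)
          fun y hy => ⟨hx.1.trans hy.1.le, hy.2.le⟩)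
      filter_upwards [hle hev] with y hy using le_of_lt hy
  exact h t ht fun s hs => hsub ⟨hs.1, hs.2.trans ht.2⟩

/-! ### The energy estimate -/

/-- The contribution of the mode `j` to `‖A^p d‖² + ‖A^{p+1} c‖²`. -/
def modeEnergy (p : ℝ) (c d : Coeffs n) (j : Fin n → ℤ) : ℝ :=
  ‖d j‖ ^ 2 * japSq j ^ p + ‖c j‖ ^ 2 * japSq j ^ (p + 1)

lemma modeEnergy_nonneg (p : ℝ) (c d : Coeffs n) (j : Fin n → ℤ) : 0 ≤ modeEnergy p c d j :=
  add_nonneg (term_nonneg _ _ _) (term_nonneg _ _ _)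

/-- In each mode the linear part of the wave equation conserves the energy, so that only the
dissipation and the defect `d' + A² c` contribute to the derivative. -/
lemma hasDerivWithinAt_modeEnergy {p x T t τ' : ℝ} {τ : ℝ → ℝ} {c d : ℝ → Coeffs n}
    {e : Coeffs n} {j : Fin n → ℤ} (hτ : HasDerivWithinAt τ τ' (Icc 0 T) t)
    (hc : HasDerivWithinAt (fun r => c r j) (d t j) (Icc 0 T) t)
    (hd : HasDerivWithinAt (fun r => d r j) (e j) (Icc 0 T) t) :
    HasDerivWithinAt (fun r => modeEnergy p (c r) (d r) j * Real.exp (2 * τ r * x))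
      (2 * japSq j ^ p * Real.exp (2 * τ t * x) *
          inner ℝ (d t j) (e j + (japSq j : ℂ) * c t j)
        + 2 * τ' * (modeEnergy p (c t) (d t) j * (x * Real.exp (2 * τ t * x)))) (Icc 0 T) t := by
  have h1 := ((hd.norm_sq.mul_const (japSq j ^ p)).add
    (hc.norm_sq.mul_const (japSq j ^ (p + 1)))).mul (((hτ.const_mul 2).mul_const x).exp)
  refine h1.congr_deriv ?_
  have h2 : inner ℝ (d t j) (e j + (japSq j : ℂ) * c t j)
      = inner ℝ (d t j) (e j) + japSq j * inner ℝ (c t j) (d t j) := by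
    rw [inner_add_right, ← Complex.real_smul, inner_smul_right, real_inner_comm (d t j) (c t j)]
  rw [h2, modeEnergy, Real.rpow_add_one (japSq_pos j).ne']
  simp only [Pi.add_apply]
  ring

lemma hasSum_modeEnergy_mul {p M : ℝ} {c d : Coeffs n} (hc : MemSobolev (p + 1) c)
    (hd : MemSobolev p d) {μ : (Fin n → ℤ) → ℝ} (hμ : ∀ j, |μ j| ≤ M) :
    HasSum (fun j => modeEnergy p c d j * μ j)
      (∑' j, ‖d j‖ ^ 2 * japSq j ^ p * μ j + ∑' j, ‖c j‖ ^ 2 * japSq j ^ (p + 1) * μ j) := by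
  simp only [modeEnergy, add_mul]
  exact (hd.summable_mul hμ).hasSum.add (hc.summable_mul hμ).hasSum

/-- The energy estimate with the bounded multiplier `φ = min(|j'|, N)`, conditional on a bound by
`Z + ε` that enters the rate `η` at which the radius `τ` decreases. -/
lemma sqrt_energy_le {m N : ℕ} {p lam T ε Y₀ : ℝ} {a : NonlinCoeffs n}
    (ha : HasEntireMajorant m p lam T a) (hp : (n : ℝ) / 2 < p) (hlam : 0 ≤ lam)
    {u₀ u₁ : L2 n} {u ut : ℝ → L2 n} (hsol : IsSolution (p + 1) T a u₀ u₁ u ut)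
    {Z η τ : ℝ → ℝ} (hε : 0 < ε) (hY₀ : 0 ≤ Y₀)
    (hκ : ContinuousOn (kappa (2 ^ (n + 2)) m p lam a u ut) (Icc 0 T))
    (hZ : ∀ t, Z t = Y₀ + ∫ s in (0 : ℝ)..t, kappa (2 ^ (n + 2)) m p lam a u ut s)
    (hη : ∀ t, η t = psi (2 ^ (n + 2)) m p lam a t (sobolevNorm (p + 1) (coeffs (u t)))
      (sobolevNorm p (coeffs (ut t))) (Z t + ε) (Z t + ε) * (Z t + ε))
    (hηc : ContinuousOn η (Icc 0 T))
    (hτ : ∀ t ∈ Icc 0 T, HasDerivWithinAt τ (-(τ t) * η t) (Icc 0 T) t)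
    (hτ0 : ∀ t ∈ Icc 0 T, 0 ≤ τ t) (hτl : ∀ t ∈ Icc 0 T, τ t ≤ lam)
    (h0 : multNorm p (τ 0) (truncHead m N) (coeffs (ut 0)) ^ 2
      + multNorm (p + 1) (τ 0) (truncHead m N) (coeffs (u 0)) ^ 2 ≤ Y₀ ^ 2)
    {t : ℝ} (ht : t ∈ Icc 0 T) :
    Real.sqrt (multNorm p (τ t) (truncHead m N) (coeffs (ut t)) ^ 2
      + multNorm (p + 1) (τ t) (truncHead m N) (coeffs (u t)) ^ 2) ≤ Z t := by
  obtain ⟨hu, hv, hdu, -, -, utt, -, hdv, hweak⟩ := hsol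
  rw [add_sub_cancel_right] at hv
  set φ : (Fin n → ℤ) → ℝ := truncHead m N with hφ_def
  have hφ0 : ∀ j, 0 ≤ φ j := truncHead_nonneg m N
  have hφN : ∀ j, φ j ≤ N := truncHead_le m N
  have hτc : ContinuousOn τ (Icc 0 T) := fun t ht => (hτ t ht).continuousWithinAt
  have hexp : ∀ r ∈ Icc 0 T, ∀ j, |Real.exp (2 * τ r * φ j)| ≤ Real.exp (2 * lam * N) :=
    fun r hr j => (abs_exp_le (hτ0 r hr) (hφN j)).trans (Real.exp_le_exp.2
      (mul_le_mul_of_nonneg_right (by linarith [hτl r hr]) N.cast_nonneg))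
  have hexp' : ∀ r ∈ Icc 0 T, ∀ j,
      |φ j * Real.exp (2 * τ r * φ j)| ≤ N * Real.exp (2 * lam * N) := fun r hr j => by
    rw [abs_mul, abs_of_nonneg (hφ0 j)]
    exact mul_le_mul (hφN j) (hexp r hr j) (abs_nonneg _) N.cast_nonneg
  have hexpc : ∀ j, ContinuousOn (fun r => Real.exp (2 * τ r * φ j)) (Icc 0 T) := fun j =>
    ((continuousOn_const.mul hτc).mul continuousOn_const).rexp
  set E : ℝ → ℝ := fun r => multNorm p (τ r) φ (coeffs (ut r)) ^ 2
    + multNorm (p + 1) (τ r) φ (coeffs (u r)) ^ 2 with hE_def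
  set D : ℝ → ℝ := fun r => dissipation p (τ r) φ (coeffs (ut r))
    + dissipation (p + 1) (τ r) φ (coeffs (u r)) with hD_def
  have hEc : ContinuousOn E (Icc 0 T) := by
    simp only [hE_def, multNorm_sq]
    exact (hv.continuousOn_tsum hexp hexpc).add (hu.continuousOn_tsum hexp hexpc)
  have hDc : ContinuousOn D (Icc 0 T) :=
    (hv.continuousOn_tsum hexp' fun j => continuousOn_const.mul (hexpc j)).add
      (hu.continuousOn_tsum hexp' fun j => continuousOn_const.mul (hexpc j))
  have hEs : ∀ r ∈ Icc 0 T, HasSum (fun j => modeEnergy p (coeffs (u r)) (coeffs (ut r)) j *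
      Real.exp (2 * τ r * φ j)) (E r) := fun r hr => by
    simp only [hE_def, multNorm_sq]
    exact hasSum_modeEnergy_mul (hu.1 r hr) (hv.1 r hr) (hexp r hr)
  have hDs : ∀ r ∈ Icc 0 T, HasSum (fun j => modeEnergy p (coeffs (u r)) (coeffs (ut r)) j *
      (φ j * Real.exp (2 * τ r * φ j))) (D r) := fun r hr =>
    hasSum_modeEnergy_mul (hu.1 r hr) (hv.1 r hr) (hexp' r hr)
  have hκ0 : ∀ s, 0 ≤ kappa (2 ^ (n + 2)) m p lam a u ut s := fun s =>
    kappa_nonneg m (by positivity) p lam a u ut s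
  have hZc : ContinuousOn Z (Icc 0 T) := by
    rw [show Z = _ from funext hZ]
    exact continuousOn_const.add (continuousOn_integral hκ)
  have hGc : ContinuousOn (fun r => Real.sqrt (E r)) (Icc 0 T) := hEc.sqrt
  have hE0 : ∀ r, 0 ≤ E r := fun r => add_nonneg (sq_nonneg _) (sq_nonneg _)
  refine le_of_bootstrap hGc hZc hε ?_ (fun b hb hboot => ?_) ht
  · rw [hZ, intervalIntegral.integral_same, add_zero]
    exact Real.sqrt_le_iff.2 ⟨hY₀, h0⟩
  have hbT : Icc 0 b ⊆ Icc 0 T := Icc_subset_Icc_right hb.2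
  rw [hZ]
  refine le_add_integral_of_sq_le (hGc.mono hbT) (hκ.mono hbT) (fun s _ => hκ0 s) hY₀
    (fun s _ => Real.sqrt_nonneg _) (fun r hr => ?_) (right_mem_Icc.2 hb.1)
  rw [Real.sq_sqrt (hE0 r)]
  have hη0 : ∀ s ∈ Icc 0 b, 0 ≤ η s := fun s hs => by
    have hz : 0 ≤ Z s + ε := (Real.sqrt_nonneg _).trans (hboot s hs)
    rw [hη]
    exact mul_nonneg (psi_nonneg m (by positivity) p lam a s (sobolevNorm_nonneg _ _)
      (sobolevNorm_nonneg _ _) hz hz) hz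
  set DJ : Finset (Fin n → ℤ) → ℝ → ℝ := fun J s =>
    ∑ j ∈ J, modeEnergy p (coeffs (u s)) (coeffs (ut s)) j *
      (φ j * Real.exp (2 * τ s * φ j)) with hDJ_def
  have hDJ0 : ∀ J s, 0 ≤ DJ J s := fun J s => Finset.sum_nonneg fun j _ =>
    mul_nonneg (modeEnergy_nonneg ..) (mul_nonneg (hφ0 j) (Real.exp_pos _).le)
  have hDJD : ∀ J, ∀ s ∈ Icc 0 T, DJ J s ≤ D s := fun J s hs =>
    sum_le_hasSum J (fun j _ => mul_nonneg (modeEnergy_nonneg ..)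
      (mul_nonneg (hφ0 j) (Real.exp_pos _).le)) (hDs s hs)
  have hmode : ∀ j, ContinuousOn
      (fun s => modeEnergy p (coeffs (u s)) (coeffs (ut s)) j) (Icc 0 T) := fun j => by
    have h1 : ContinuousOn (fun s => coeffs (u s) j) (Icc 0 T) := fun s hs =>
      (hdu s hs j).continuousWithinAt
    have h2 : ContinuousOn (fun s => coeffs (ut s) j) (Icc 0 T) := fun s hs =>
      (hdv s hs j).continuousWithinAt
    exact ((h2.norm.pow 2).mul continuousOn_const).add ((h1.norm.pow 2).mul continuousOn_const)
  have hDJc : ∀ J, ContinuousOn (DJ J) (Icc 0 T) := fun J =>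
    continuousOn_finsetSum J fun j _ => (hmode j).mul (continuousOn_const.mul (hexpc j))
  have hG1 : ContinuousOn (fun s => 2 * kappa (2 ^ (n + 2)) m p lam a u ut s * Real.sqrt (E s))
      (Icc 0 T) := (continuousOn_const.mul hκ).mul hGc
  have hrem : ∀ J, ContinuousOn (fun s => 2 * τ s * η s * (D s - DJ J s)) (Icc 0 T) := fun J =>
    ((continuousOn_const.mul hτc).mul hηc).mul (hDc.sub (hDJc J))
  have hrT : r ∈ Icc 0 T := hbT hr
  have hle : ∀ J : Finset (Fin n → ℤ),
      ∑ j ∈ J, modeEnergy p (coeffs (u r)) (coeffs (ut r)) j * Real.exp (2 * τ r * φ j)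
        ≤ Y₀ ^ 2 + (∫ s in (0 : ℝ)..r, 2 * kappa (2 ^ (n + 2)) m p lam a u ut s * Real.sqrt (E s))
          + ∫ s in (0 : ℝ)..r, 2 * τ s * η s * (D s - DJ J s) := by
    intro J
    refine le_of_hasDerivWithinAt_le (T := b)
      (f := fun r => ∑ j ∈ J, modeEnergy p (coeffs (u r)) (coeffs (ut r)) j *
        Real.exp (2 * τ r * φ j))
      (g := fun r => Y₀ ^ 2
        + (∫ s in (0 : ℝ)..r, 2 * kappa (2 ^ (n + 2)) m p lam a u ut s * Real.sqrt (E s))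
        + ∫ s in (0 : ℝ)..r, 2 * τ s * η s * (D s - DJ J s))
      (fun s hs => HasDerivWithinAt.fun_sum fun j _ => (hasDerivWithinAt_modeEnergy
        (hτ s (hbT hs)) (hdu s (hbT hs) j) (hdv s (hbT hs) j)).mono hbT)
      (fun s hs => (((hasDerivWithinAt_integral (hG1.mono hbT) hs).const_add _).add
        (hasDerivWithinAt_integral ((hrem J).mono hbT) hs))) ?_ (fun s hs => ?_) hr
    · simp only [intervalIntegral.integral_same, add_zero]
      exact (sum_le_hasSum J (fun j _ => mul_nonneg (modeEnergy_nonneg ..) (Real.exp_pos _).le)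
        (hEs 0 (left_mem_Icc.2 (hb.1.trans hb.2)))).trans h0
    · have hsT := hbT hs
      obtain ⟨du, hdu', hc⟩ := hweak s hsT
      have hUG : multNorm (p + 1) (τ s) φ (coeffs (u s)) ≤ Real.sqrt (E s) :=
        Real.le_sqrt_of_sq_le (le_add_of_nonneg_left (sq_nonneg _))
      have hVG : multNorm p (τ s) φ (coeffs (ut s)) ≤ Real.sqrt (E s) :=
        Real.le_sqrt_of_sq_le (le_add_of_nonneg_right (sq_nonneg _))
      have hprod := energy_production_le ha hsT hp hlam (hτ0 s hsT) hφ0 hφN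
        (truncHead_le_add m N) (fun j => mul_le_mul (hτl s hsT) (truncHead_le_absHead m N j)
          (hφ0 j) hlam) (hu.1 s hsT) (hv.1 s hsT) hdu' hc hUG hVG (hboot s hs) J
      rw [← hη, add_comm (dissipation (p + 1) _ _ _)] at hprod
      have hinner : ∑ j ∈ J, 2 * japSq j ^ p * Real.exp (2 * τ s * φ j) *
          inner ℝ (coeffs (ut s) j) (utt s j + (japSq j : ℂ) * coeffs (u s) j)
          ≤ ∑ j ∈ J, 2 * (weight p (τ s) φ j * ‖coeffs (ut s) j‖) *
            (weight p (τ s) φ j * ‖utt s j + (japSq j : ℂ) * coeffs (u s) j‖) := by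
        refine Finset.sum_le_sum fun j _ => ?_
        have h1 := mul_le_mul_of_nonneg_left (real_inner_le_norm (coeffs (ut s) j)
          (utt s j + (japSq j : ℂ) * coeffs (u s) j)) (sq_nonneg (weight p (τ s) φ j))
        rw [weight_sq] at h1
        calc _ = 2 * (japSq j ^ p * Real.exp (2 * τ s * φ j) * inner ℝ (coeffs (ut s) j)
              (utt s j + (japSq j : ℂ) * coeffs (u s) j)) := by ring
          _ ≤ 2 * (japSq j ^ p * Real.exp (2 * τ s * φ j) * (‖coeffs (ut s) j‖ *
              ‖utt s j + (japSq j : ℂ) * coeffs (u s) j‖)) :=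
            mul_le_mul_of_nonneg_left h1 zero_le_two
          _ = _ := by rw [← weight_sq]; ring
      rw [Finset.sum_add_distrib, ← Finset.mul_sum]
      calc _ ≤ 2 * kappa (2 ^ (n + 2)) m p lam a u ut s * Real.sqrt (E s)
            + 2 * τ s * η s * D s + 2 * (-(τ s) * η s) * DJ J s :=
            add_le_add_left (hinner.trans hprod) _
        _ = _ := by ring
  have hlim : Tendsto (fun J => ∫ s in (0 : ℝ)..r, 2 * τ s * η s * (D s - DJ J s)) atTop
      (𝓝 (∫ _s in (0 : ℝ)..r, (0 : ℝ))) := by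
    have hmem : ∀ {s}, s ∈ uIoc 0 r → s ∈ Icc 0 b := fun {s} hs => by
      rw [uIoc_of_le hr.1] at hs
      exact ⟨hs.1.le, hs.2.trans hr.2⟩
    refine intervalIntegral.tendsto_integral_filter_of_dominated_convergence
      (fun s => 2 * τ s * η s * D s) (Eventually.of_forall fun J => ?_)
      (Eventually.of_forall fun J => Eventually.of_forall fun s hs => ?_)
      (intervalIntegrable_of_continuousOn (((continuousOn_const.mul hτc).mul hηc).mul hDc) hrT)
      (Eventually.of_forall fun s hs => ?_)
    · exact (intervalIntegrable_of_continuousOn (hrem J) hrT).aestronglyMeasurable_restrict_uIoc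
    · have hs' := hmem hs
      have h1 := hDJD J s (hbT hs')
      have h2 := hDJ0 J s
      have h3 : 0 ≤ 2 * τ s * η s :=
        mul_nonneg (mul_nonneg zero_le_two (hτ0 s (hbT hs'))) (hη0 s hs')
      rw [Real.norm_of_nonneg (mul_nonneg h3 (sub_nonneg.2 h1))]
      exact mul_le_mul_of_nonneg_left (by linarith) h3
    · have h1 : Tendsto (fun J => DJ J s) atTop (𝓝 (D s)) := hDs s (hbT (hmem hs))
      simpa using (h1.const_sub (D s)).const_mul (2 * τ s * η s)
  have hfin := le_of_tendsto_of_tendsto (hEs r hrT) (hlim.const_add _)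
    (Eventually.of_forall hle)
  simpa using hfin

/-! ### The radius and its regularisation -/

lemma hasDerivWithinAt_radius {T τ₀ : ℝ} {η : ℝ → ℝ} (hη : ContinuousOn η (Icc 0 T)) {t : ℝ}
    (ht : t ∈ Icc 0 T) :
    HasDerivWithinAt (radius τ₀ η) (-(radius τ₀ η t) * η t) (Icc 0 T) t := by
  refine ((hasDerivWithinAt_integral hη ht).fun_neg.exp.const_mul τ₀).congr_deriv ?_
  rw [radius]
  ring

lemma radius_zero (τ₀ : ℝ) (η : ℝ → ℝ) : radius τ₀ η 0 = τ₀ := by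
  simp [radius]

lemma radius_nonneg {τ₀ : ℝ} (h : 0 ≤ τ₀) (η : ℝ → ℝ) (t : ℝ) : 0 ≤ radius τ₀ η t :=
  mul_nonneg h (Real.exp_pos _).le

lemma radius_le {T τ₀ : ℝ} (h : 0 ≤ τ₀) {η : ℝ → ℝ} (hη : ∀ t ∈ Icc 0 T, 0 ≤ η t) {t : ℝ}
    (ht : t ∈ Icc 0 T) : radius τ₀ η t ≤ τ₀ :=
  mul_le_of_le_one_right h
    (Real.exp_le_one_iff.2 (neg_nonpos.2 (integral_nonneg_of_Icc hη ht)))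

lemma continuousOn_majorant_slots {m : ℕ} {p lam T : ℝ} {a : NonlinCoeffs n}
    (ha : HasEntireMajorant m p lam T a) {S : Set ℝ} (hS : S ⊆ Icc 0 T) {f₀ f₁ : ℝ → ℝ}
    (h₀ : ContinuousOn f₀ S) (h₁ : ContinuousOn f₁ S) :
    ContinuousOn (fun t => majorant m p lam a t (slots (f₀ t) (fun _ => f₀ t) (f₁ t))) S := by
  refine ha.continuousOn_majorant.comp (continuousOn_id.prodMk
    (continuousOn_pi.2 fun k => ?_)) fun t ht => ⟨hS ht, mem_univ _⟩
  exact (slots_cases (fun _ f => ContinuousOn f S) h₀ (fun _ => h₀) h₁ k).congr fun t _ =>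
    (slots_comp (fun f : ℝ → ℝ => f t) f₀ (fun _ => f₀) f₁ k).symm

lemma continuousOn_kappa {m : ℕ} {p lam T C : ℝ} {a : NonlinCoeffs n}
    (ha : HasEntireMajorant m p lam T a) {u ut : ℝ → L2 n}
    (hu : ContSobolev T (p + 1) fun t => coeffs (u t))
    (hv : ContSobolev T p fun t => coeffs (ut t)) :
    ContinuousOn (kappa C m p lam a u ut) (Icc 0 T) := by
  refine (continuousOn_const.mul ?_).add (continuousOn_const.mul ?_)
  · exact ha.continuousOn_majorant.comp (continuousOn_id.prodMk continuousOn_const)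
      fun t ht => ⟨ht, mem_univ _⟩
  · exact continuousOn_majorant_slots ha Subset.rfl
      (continuousOn_const.mul hu.continuousOn_sobolevNorm)
      (continuousOn_const.mul hv.continuousOn_sobolevNorm)

lemma continuousOn_psi {m : ℕ} {p lam T C : ℝ} {a : NonlinCoeffs n}
    (ha : HasEntireMajorant m p lam T a) {N₁ N₂ G : ℝ → ℝ} (h₁ : ContinuousOn N₁ (Icc 0 T))
    (h₂ : ContinuousOn N₂ (Icc 0 T)) (hG : ContinuousOn G (Icc 0 T)) :
    ContinuousOn (fun t => psi C m p lam a t (N₁ t) (N₂ t) (G t) (G t)) (Icc 0 T) :=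
  continuousOn_const.mul (continuousOn_majorant_slots ha Subset.rfl
    (continuousOn_const.mul (((continuousOn_const.add h₁).add hG).pow _))
    (continuousOn_const.mul (((continuousOn_const.add h₂).add hG).pow _)))

lemma psi_mono {m : ℕ} {p lam T C t : ℝ} {a : NonlinCoeffs n}
    (ha : HasEntireMajorant m p lam T a) (hC : 0 ≤ C) (ht : t ∈ Icc 0 T) {N₁ N₂ G G' : ℝ}
    (hN₁ : 0 ≤ N₁) (hN₂ : 0 ≤ N₂) (hG : 0 ≤ G) (hGG' : G ≤ G') :
    psi C m p lam a t N₁ N₂ G G ≤ psi C m p lam a t N₁ N₂ G' G' := by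
  have h := algConst_nonneg (n := n) (p := p)
  refine mul_le_mul_of_nonneg_left (majorant_mono (ha.summable_majorant t ht)
    (slots_nonneg (by positivity) (by positivity)) (slots_le_slots ?_ ?_)) (by positivity) <;>
  gcongr

lemma continuous_psi {m : ℕ} {p lam T C t : ℝ} {a : NonlinCoeffs n}
    (ha : HasEntireMajorant m p lam T a) (ht : t ∈ Icc 0 T) (N₁ N₂ : ℝ) :
    Continuous fun G => psi C m p lam a t N₁ N₂ G G := by
  have h1 : Continuous fun s : Fin (n + 2) → ℝ => majorant m p lam a t s :=
    continuousOn_univ.1 (ha.continuousOn_majorant.comp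
      (continuousOn_const.prodMk continuousOn_id) fun s _ => ⟨ht, mem_univ s⟩)
  refine continuous_const.mul (h1.comp (continuous_pi fun k => ?_))
  refine (slots_cases (fun _ f => Continuous f) (by fun_prop) (fun _ => by fun_prop)
    (by fun_prop) k).congr fun G => (slots_comp (fun f : ℝ → ℝ => f G)
      (fun G => 2 * Real.exp 1 * algConst n p * (1 + N₁ + G) ^ (n + 2))
      (fun _ G => 2 * Real.exp 1 * algConst n p * (1 + N₁ + G) ^ (n + 2))
      (fun G => 2 * Real.exp 1 * algConst n p * (1 + N₂ + G) ^ (n + 2)) k)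

lemma tendsto_radius {T τ₀ t : ℝ} {F : ℝ → ℝ → ℝ} (ht : t ∈ Icc 0 T)
    (hF : ∀ ε, ContinuousOn (F ε) (Icc 0 T)) (h0 : ∀ ε, 0 ≤ ε → ∀ s ∈ Icc 0 T, 0 ≤ F ε s)
    (hmono : ∀ ε, 0 ≤ ε → ε ≤ 1 → ∀ s ∈ Icc 0 T, F ε s ≤ F 1 s)
    (hc : ∀ s ∈ Icc 0 T, Continuous fun ε => F ε s) :
    Tendsto (fun ε => radius τ₀ (F ε) t) (𝓝[>] 0) (𝓝 (radius τ₀ (F 0) t)) := by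
  have hmem : ∀ {s}, s ∈ uIoc 0 t → s ∈ Icc 0 T := fun {s} hs => by
    rw [uIoc_of_le ht.1] at hs
    exact ⟨hs.1.le, hs.2.trans ht.2⟩
  have h1 : Tendsto (fun ε => ∫ s in (0 : ℝ)..t, F ε s) (𝓝[>] 0)
      (𝓝 (∫ s in (0 : ℝ)..t, F 0 s)) := by
    refine intervalIntegral.tendsto_integral_filter_of_dominated_convergence (F 1)
      (Eventually.of_forall fun ε => (intervalIntegrable_of_continuousOn (hF ε)
        ht).aestronglyMeasurable_restrict_uIoc) ?_ (intervalIntegrable_of_continuousOn (hF 1) ht)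
      (Eventually.of_forall fun s hs => ?_)
    · filter_upwards [Ioc_mem_nhdsGT (zero_lt_one' ℝ)] with ε hε
      refine Eventually.of_forall fun s hs => ?_
      rw [Real.norm_of_nonneg (h0 ε hε.1.le s (hmem hs))]
      exact hmono ε hε.1.le hε.2 s (hmem hs)
    · exact ((hc s (hmem hs)).tendsto 0).mono_left nhdsWithin_le_nhds
  exact (h1.neg.rexp).const_mul τ₀

lemma gevreyNorm_eq (m : ℕ) (s τ : ℝ) (c : Coeffs n) :
    gevreyNorm m s τ c = multNorm s τ (absHead m) c := rfl

lemma multNorm_truncHead_le {m N : ℕ} {s θ : ℝ} {c : Coeffs n} (hθ : 0 ≤ θ)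
    (hc : MemSobolev s c) (h : MemGevrey m s θ c) :
    multNorm s θ (truncHead m N) c ^ 2 ≤ gevreyNorm m s θ c ^ 2 := by
  rw [gevreyNorm_eq, multNorm_sq, multNorm_sq]
  refine Summable.tsum_le_tsum (fun j => ?_)
    (hc.summable_mul fun j => abs_exp_le hθ (truncHead_le m N j)) h
  exact mul_le_mul_of_nonneg_left (Real.exp_le_exp.2 (mul_le_mul_of_nonneg_left
    (truncHead_le_absHead m N j) (by positivity))) (term_nonneg s c j)

lemma MemGevrey.mono {m : ℕ} {s θ θ' : ℝ} {c : Coeffs n} (h : MemGevrey m s θ c) (hθ : θ' ≤ θ) :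
    MemGevrey m s θ' c :=
  Summable.of_nonneg_of_le (fun j => mul_nonneg (term_nonneg s c j) (Real.exp_pos _).le)
    (fun j => mul_le_mul_of_nonneg_left (Real.exp_le_exp.2 (mul_le_mul_of_nonneg_right
      (by linarith) (absHead_nonneg m j))) (term_nonneg s c j)) h

/-- Bounds for the truncated norms that are uniform in the truncation, with exponents converging
to `θ`, give the full Gevrey regularity with exponent `θ`. -/
lemma memGevrey_of_tendsto {m : ℕ} {s θ Z : ℝ} {c : Coeffs n} {θε : ℝ → ℝ}
    (hc : MemSobolev s c) (hθε : ∀ ε, 0 ≤ θε ε) (hlim : Tendsto θε (𝓝[>] 0) (𝓝 θ))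
    (hb : ∀ ε, 0 < ε → ∀ N, multNorm s (θε ε) (truncHead m N) c ^ 2 ≤ Z) :
    MemGevrey m s θ c := by
  refine summable_of_sum_le (c := Z)
    (fun j => mul_nonneg (term_nonneg s c j) (Real.exp_pos _).le) fun J => ?_
  obtain ⟨N, hN⟩ := exists_nat_ge (∑ j ∈ J, absHead m j)
  have hJ : ∀ j ∈ J, truncHead m N j = absHead m j := fun j hj =>
    min_eq_left ((Finset.single_le_sum (fun j _ => absHead_nonneg m j) hj).trans hN)
  have hl : Tendsto (fun ε => ∑ j ∈ J, ‖c j‖ ^ 2 * japSq j ^ s *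
      Real.exp (2 * θε ε * absHead m j)) (𝓝[>] 0)
      (𝓝 (∑ j ∈ J, ‖c j‖ ^ 2 * japSq j ^ s * Real.exp (2 * θ * absHead m j))) :=
    tendsto_finsetSum J fun j _ => (((hlim.const_mul 2).mul_const _).rexp).const_mul _
  refine le_of_tendsto hl ?_
  filter_upwards [self_mem_nhdsWithin] with ε hε
  refine le_trans ?_ (hb ε hε N)
  rw [multNorm_sq]
  refine le_trans (le_of_eq (Finset.sum_congr rfl fun j hj => by rw [hJ j hj]))
    ((hc.summable_mul fun j => abs_exp_le (hθε ε) (truncHead_le m N j)).sum_le_tsum J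
      fun j _ => mul_nonneg (term_nonneg s c j) (Real.exp_pos _).le)

end GevreyWave

end

theorem theorem2 (n : ℕ) (p : ℝ) (hp : (n : ℝ) / 2 < p) :
    ∃ C : ℝ, 0 < C ∧
      ∀ (m : ℕ), 1 ≤ m → m ≤ n →
      ∀ (lam σ T : ℝ), 0 < lam → 0 < σ → 0 < T →
      ∀ (a : GevreyWave.NonlinCoeffs n), GevreyWave.HasEntireMajorant m p lam T a →
      ∀ (u₀ u₁ : GevreyWave.L2 n),
        GevreyWave.MemGevrey m (p + 1) σ (GevreyWave.coeffs u₀) →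
        GevreyWave.MemGevrey m p σ (GevreyWave.coeffs u₁) →
      ∀ (u ut : ℝ → GevreyWave.L2 n), GevreyWave.IsSolution (p + 1) T a u₀ u₁ u ut →
      ∀ (τ₀ : ℝ) (κ η τ : ℝ → ℝ),
        τ₀ = min σ lam →
        κ = GevreyWave.kappa C m p lam a u ut →
        η = GevreyWave.eta C m p lam τ₀ a u₀ u₁ u ut →
        τ = GevreyWave.radius τ₀ η →
        ContinuousOn κ (Set.Icc 0 T) ∧
        ContinuousOn η (Set.Icc 0 T) ∧
        (∀ t ∈ Set.Icc 0 T, 0 ≤ η t) ∧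
        τ 0 = τ₀ ∧
        (∀ t ∈ Set.Icc 0 T, HasDerivWithinAt τ (-(τ t) * η t) (Set.Icc 0 T) t) ∧
        ∀ t ∈ Set.Icc 0 T,
          GevreyWave.MemGevrey m (p + 1) (τ t) (GevreyWave.coeffs (u t)) ∧
          GevreyWave.MemGevrey m p (τ t) (GevreyWave.coeffs (ut t)) := by
  open GevreyWave in
  refine ⟨2 ^ (n + 2), by positivity, ?_⟩
  rintro m - - lam σ T hlam hσ hT a ha u₀ u₁ hu₀ hu₁ u ut hsol τ₀ κ η τ hτ₀ hκ_def hη_def hτ_def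
  have hC : (0 : ℝ) ≤ 2 ^ (n + 2) := by positivity
  have hτ₀0 : 0 ≤ τ₀ := hτ₀ ▸ (lt_min hσ hlam).le
  have hu := hsol.1
  have hv := hsol.2.1
  rw [add_sub_cancel_right] at hv
  have hκc : ContinuousOn (kappa (2 ^ (n + 2)) m p lam a u ut) (Icc 0 T) :=
    continuousOn_kappa ha hu hv
  have hκ0 : ∀ t, 0 ≤ kappa (2 ^ (n + 2)) m p lam a u ut t := fun t =>
    kappa_nonneg m hC p lam a u ut t
  set Y₀ := initialSize m p τ₀ u₀ u₁ with hY₀_def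
  have hY₀ : 0 ≤ Y₀ := Real.sqrt_nonneg _
  set Z : ℝ → ℝ := fun t => Y₀ + ∫ s in (0 : ℝ)..t, kappa (2 ^ (n + 2)) m p lam a u ut s with hZ
  have hZc : ContinuousOn Z (Icc 0 T) := continuousOn_const.add (continuousOn_integral hκc)
  have hZ0 : ∀ t ∈ Icc 0 T, 0 ≤ Z t := fun t ht =>
    add_nonneg hY₀ (integral_nonneg_of_Icc (fun s _ => hκ0 s) ht)
  -- `F ε` is the rate `η` with `Z` replaced by `Z + ε`; the exact rate is `F 0`
  set F : ℝ → ℝ → ℝ := fun ε t => psi (2 ^ (n + 2)) m p lam a t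
    (sobolevNorm (p + 1) (coeffs (u t))) (sobolevNorm p (coeffs (ut t))) (Z t + ε) (Z t + ε)
      * (Z t + ε) with hF
  have hηF : η = F 0 := by
    rw [hη_def]
    funext t
    simp only [hF, add_zero]
    rfl
  have hFc : ∀ ε, ContinuousOn (F ε) (Icc 0 T) := fun ε =>
    (continuousOn_psi ha hu.continuousOn_sobolevNorm hv.continuousOn_sobolevNorm
      (hZc.add continuousOn_const)).mul (hZc.add continuousOn_const)
  have hF0 : ∀ ε, 0 ≤ ε → ∀ t ∈ Icc 0 T, 0 ≤ F ε t := fun ε hε t ht => by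
    have h := add_nonneg (hZ0 t ht) hε
    exact mul_nonneg (psi_nonneg m hC p lam a t (sobolevNorm_nonneg _ _)
      (sobolevNorm_nonneg _ _) h h) h
  have hFmono : ∀ ε, 0 ≤ ε → ε ≤ 1 → ∀ t ∈ Icc 0 T, F ε t ≤ F 1 t := fun ε hε hε1 t ht => by
    have h := add_nonneg (hZ0 t ht) hε
    have h1 : 0 ≤ Z t + 1 := add_nonneg (hZ0 t ht) zero_le_one
    exact mul_le_mul (psi_mono ha hC ht (sobolevNorm_nonneg _ _) (sobolevNorm_nonneg _ _) h
      (by linarith)) (by linarith) h (psi_nonneg m hC p lam a t (sobolevNorm_nonneg _ _)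
      (sobolevNorm_nonneg _ _) h1 h1)
  have hFε : ∀ t ∈ Icc 0 T, Continuous fun ε => F ε t := fun t ht =>
    ((continuous_psi ha ht _ _).comp (continuous_const.add continuous_id)).mul
      (continuous_const.add continuous_id)
  have hbound : ∀ t ∈ Icc 0 T, ∀ ε, 0 < ε → ∀ N,
      multNorm p (radius τ₀ (F ε) t) (truncHead m N) (coeffs (ut t)) ^ 2
        + multNorm (p + 1) (radius τ₀ (F ε) t) (truncHead m N) (coeffs (u t)) ^ 2
          ≤ Z t ^ 2 := fun t ht ε hε N => by
    refine (Real.sqrt_le_left (hZ0 t ht)).1 (sqrt_energy_le ha hp hlam.le hsol hε hY₀ hκc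
      (fun _ => rfl) (fun _ => rfl) (hFc ε) (fun s hs => hasDerivWithinAt_radius (hFc ε) hs)
      (fun s _ => radius_nonneg hτ₀0 _ s)
      (fun s hs => (radius_le hτ₀0 (hF0 ε hε.le) hs).trans (hτ₀ ▸ min_le_right _ _)) ?_ ht)
    have h0 : (0 : ℝ) ∈ Icc 0 T := left_mem_Icc.2 hT.le
    have hτσ : τ₀ ≤ σ := hτ₀ ▸ min_le_left _ _
    have hu0 := hu.1 0 h0
    have hv0 := hv.1 0 h0
    obtain ⟨-, -, -, h1, h2, -⟩ := hsol
    simp only [h1, h2] at hu0 hv0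
    rw [radius_zero, h1, h2, hY₀_def, initialSize,
      Real.sq_sqrt (add_nonneg (sq_nonneg _) (sq_nonneg _))]
    exact add_le_add (multNorm_truncHead_le hτ₀0 hv0 (hu₁.mono hτσ))
      (multNorm_truncHead_le hτ₀0 hu0 (hu₀.mono hτσ))
  subst hκ_def hτ_def
  rw [hηF]
  refine ⟨hκc, hFc 0, hF0 0 le_rfl, radius_zero _ _,
    fun t ht => hasDerivWithinAt_radius (hFc 0) ht, fun t ht => ?_⟩
  have hlim := tendsto_radius (τ₀ := τ₀) ht hFc hF0 hFmono hFε
  exact ⟨memGevrey_of_tendsto (hu.1 t ht) (fun ε => radius_nonneg hτ₀0 _ t) hlim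
      fun ε hε N => (le_add_of_nonneg_left (sq_nonneg _)).trans (hbound t ht ε hε N),
    memGevrey_of_tendsto (hv.1 t ht) (fun ε => radius_nonneg hτ₀0 _ t) hlim
      fun ε hε N => (le_add_of_nonneg_right (sq_nonneg _)).trans (hbound t ht ε hε N)⟩
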